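/- Let $\Gamma$ be a commutative cancellative monoid (written additively) whose quotient group $\langle\Gamma\rangle$ is torsion-free, let $R=\bigoplus_{\alpha\in\Gamma}R_\alpha$ be a $\Gamma$-graded integral domain with quotient field $K$, let $H$ be the set of nonzero homogeneous elements of $R$, and let $R_H=\{a/s : a\in R,\ s\in H\}\subseteq K$, which is graded by $\langle\Gamma\rangle$. A semistar operation on $R$ is a map $E\mapsto E^\star$ on the nonzero $R$-submodules of $K$ such that $(xE)^\star=xE^\star$ for $0\ne x\in K$, $E\subseteq F$ implies $E^\star\subseteq F^\star$, $E\subseteq E^\star$, and $(E^\star)^\star=E^\star$. Let $f(R)$ be the set of nonzero finitely generated $R$-submodules of $K$. The operation $\star$ is e.a.b. if for all $E,F,G\in f(R)$, $(EF)^\star\subseteq(EG)^\star$ implies $F^\star\subseteq G^\star$. The operation $\star_a$ is defined by $F^{\star_a}=\bigcup\{((FJ)^\star:J^\star) : J\in f(R)\}$ for $F\in f(R)$ and $E^{\star_a}=\bigcup\{F^{\star_a} : F\in f(R),\ F\subseteq E\}$ in general. A fractional ideal $E$ is homogeneous if $sE$ is a homogeneous ideal of $R$ for some $s\in H$; an $R$-submodule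 $E$ of $K$ is homogeneous if $E=\bigoplus_{\alpha\in\langle\Gamma\rangle}(E\cap(R_H)_\alpha)$; $\star$ is homogeneous preserving if $E^\star$ is a homogeneous submodule for every nonzero homogeneous fractional ideal $E$ of $R$. For $a\in R$ let $C(a)$ be the ideal of $R$ generated by the homogeneous components of $a$, and for $f=\sum_i f_iX^i\in R[X]$ let $\mathcal A_f=\sum_i C(f_i)$. Let $\mathrm{Kr}(R,\star)\subseteq K(X)$ be the set of all $f/g$ with $f,g\in R[X]$, $g\neq0$, for which there is $0\neq h\in R[X]$ with $\mathcal A_f\mathcal A_h\subseteq(\mathcal A_g\mathcal A_h)^\star$. (A) Let $\star$ be an e.a.b. semistar operation on $R$. Then $\mathrm{Kr}(R,\star)=\{f/g : f,g\in R[X],\ g\ne0,\ \mathcal A_f\subseteq\mathcal A_g^\star\}$, and $\mathrm{Kr}(R,\star)$ is a subring of $K(X)$, an integral domain and a Bézout domain. If moreover $\star$ is homogeneous preserving, then $I^\star=I\,\mathrm{Kr}(R,\star)\cap R_H$ for every nonzero finitely generated homogeneous ideal $I$ of $R$. (B) Let $\star$ be a homogeneous preserving semistar operation on $R$ with $R^\star\subsetneq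 R_H$. Then 1. $\mathrm{Kr}(R,\star)=\mathrm{Kr}(R,\star_a)$; 2. $\mathrm{Kr}(R,\star)$ is a subring of $K(X)$ and a Bézout domain; 3. $I^{\star_a}=I\,\mathrm{Kr}(R,\star)\cap R_H$ for every nonzero finitely generated homogeneous ideal $I$ of $R$. -/

import Mathlib

open scoped Pointwise Polynomial nonZeroDivisors

namespace GradedKronecker

/-! ### Semistar operations -/

/-- A semistar operation on the domain `R` with quotient field `K`: a map `E ↦ E^⋆` on the nonzero
`R`-submodules of `K` such that `(xE)^⋆ = xE^⋆` for `0 ≠ x ∈ K`, `E ⊆ F` implies `E^⋆ ⊆ F^⋆`,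
`E ⊆ E^⋆`, and `E^⋆⋆ = E^⋆`. It is extended to the zero submodule by `0^⋆ = 0`; with this
convention (`map_bot`) the four laws hold for all submodules as soon as they hold for the
nonzero ones, so the structure carries the same data as a map on the nonzero submodules. -/
structure SemistarOperation (R K : Type*) [CommRing R] [Field K] [Algebra R K] where
  /-- The map `E ↦ E^⋆`. -/
  toFun : Submodule R K → Submodule R K
  map_bot : toFun ⊥ = ⊥
  map_smul : ∀ (x : K), x ≠ 0 → ∀ E : Submodule R K, toFun (x • E) = x • toFun E
  mono : ∀ E F : Submodule R K, E ≤ F → toFun E ≤ toFun F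
  le_self : ∀ E : Submodule R K, E ≤ toFun E
  idem : ∀ E : Submodule R K, toFun (toFun E) = toFun E

instance {R K : Type*} [CommRing R] [Field K] [Algebra R K] :
    CoeFun (SemistarOperation R K) (fun _ => Submodule R K → Submodule R K) :=
  ⟨SemistarOperation.toFun⟩

namespace SemistarOperation

variable {R K : Type*} [CommRing R] [Field K] [Algebra R K]

/-- `⋆` is e.a.b. (endlich arithmetisch brauchbar): for all nonzero finitely generated fractional
ideals `E, F, G` of `R` (that is, nonzero finitely generated `R`-submodules of `K`),
`(EF)^⋆ ⊆ (EG)^⋆` implies `F^⋆ ⊆ G^⋆`. -/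
def IsEAB (star : SemistarOperation R K) : Prop :=
  ∀ E F G : Submodule R K, E.FG → E ≠ ⊥ → F.FG → F ≠ ⊥ → G.FG → G ≠ ⊥ →
    star (E * F) ≤ star (E * G) → star F ≤ star G

theorem fg_one_submodule : (1 : Submodule R K).FG := by
  rw [Submodule.one_eq_span]
  exact Submodule.fg_span_singleton 1

theorem smul_mem (star : SemistarOperation R K) {A B : Submodule R K} (y : K)
    (h : ∀ a ∈ A, y * a ∈ B) {x : K} (hx : x ∈ star A) : y * x ∈ star B := by
  rcases eq_or_ne y 0 with rfl | hy
  · simp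
  · have h1 : y • A ≤ B := by
      rintro _ ⟨a, ha, rfl⟩
      exact h a ha
    have h2 := star.mono _ _ h1
    rw [star.map_smul y hy] at h2
    exact h2 (Submodule.smul_mem_pointwise_smul x y _ hx)

theorem mul_star_le (star : SemistarOperation R K) (A B : Submodule R K) :
    star A * B ≤ star (A * B) := by
  rw [Submodule.mul_le]
  intro x hx b hb
  have h : ∀ a ∈ A, b * a ∈ A * B := fun a ha => by
    rw [mul_comm b a]
    exact Submodule.mul_mem_mul ha hb
  rw [mul_comm x b]
  exact star.smul_mem b h hx

theorem mem_star_div (star : SemistarOperation R K) {A H : Submodule R K} {x : K} :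
    x ∈ star A / star H ↔ ∀ y ∈ H, x * y ∈ star A := by
  rw [Submodule.mem_div_iff_forall_mul_mem]
  refine ⟨fun h y hy => h y (star.le_self _ hy), fun h y hy => ?_⟩
  rw [← star.idem A]
  exact star.smul_mem x h hy

theorem mem_star_div_mono (star : SemistarOperation R K) {F F' H G : Submodule R K} (hF : F ≤ F')
    {x : K} (hx : x ∈ star (F * H) / star H) : x ∈ star (F' * (H * G)) / star (H * G) := by
  rw [mem_star_div] at hx ⊢
  have h1 : Submodule.span R {x} * H ≤ star (F * H) := by
    rw [Submodule.mul_le]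
    intro m hm y hy
    obtain ⟨r, rfl⟩ := Submodule.mem_span_singleton.1 hm
    rw [smul_mul_assoc]
    exact Submodule.smul_mem _ _ (hx y hy)
  have h2 : Submodule.span R {x} * (H * G) ≤ star (F' * (H * G)) := by
    rw [← mul_assoc, ← mul_assoc]
    refine (mul_le_mul' h1 le_rfl).trans ((star.mul_star_le _ _).trans (star.mono _ _ ?_))
    exact mul_le_mul' (mul_le_mul' hF le_rfl) le_rfl
  intro y hy
  exact h2 (Submodule.mul_mem_mul (Submodule.mem_span_singleton_self x) hy)

/-- `E^{⋆_a}`, the union of all `((FH)^⋆ : H^⋆)` where `F ⊆ E` is finitely generated and `H` is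
nonzero and finitely generated. (For `F = 0` the set is `{0}`, so that allowing `F = 0` changes
nothing for `E ≠ 0` and gives `0^{⋆_a} = 0`.) For finitely generated `E` this is the union
of all `((EH)^⋆ : H^⋆)`; see `mem_eabFun_of_fg`. -/
def eabFun (star : SemistarOperation R K) (E : Submodule R K) : Submodule R K where
  carrier := {x | ∃ F : Submodule R K, F.FG ∧ F ≤ E ∧ ∃ H : Submodule R K, H.FG ∧ H ≠ ⊥ ∧
    x ∈ star (F * H) / star H}
  zero_mem' := ⟨⊥, Submodule.fg_bot, bot_le, 1, fg_one_submodule, one_ne_zero,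
    Submodule.zero_mem _⟩
  add_mem' := by
    rintro x y ⟨F, hF, hFE, H, hH, hH0, hx⟩ ⟨F', hF', hFE', H', hH', hH0', hy⟩
    refine ⟨F ⊔ F', hF.sup hF', sup_le hFE hFE', H * H', hH.mul hH', mul_ne_zero hH0 hH0',
      Submodule.add_mem _ (star.mem_star_div_mono le_sup_left hx) ?_⟩
    rw [mul_comm H H']
    exact star.mem_star_div_mono le_sup_right hy
  smul_mem' := by
    rintro r x ⟨F, hF, hFE, H, hH, hH0, hx⟩
    exact ⟨F, hF, hFE, H, hH, hH0, Submodule.smul_mem _ _ hx⟩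

theorem mem_eabFun (star : SemistarOperation R K) {E : Submodule R K} {x : K} :
    x ∈ star.eabFun E ↔ ∃ F : Submodule R K, F.FG ∧ F ≤ E ∧ ∃ H : Submodule R K, H.FG ∧ H ≠ ⊥ ∧
      x ∈ star (F * H) / star H := Iff.rfl

theorem mem_eabFun_of_fg (star : SemistarOperation R K) {E : Submodule R K} (hE : E.FG) {x : K} :
    x ∈ star.eabFun E ↔
      ∃ H : Submodule R K, H.FG ∧ H ≠ ⊥ ∧ x ∈ star (E * H) / star H := by
  constructor
  · rintro ⟨F, -, hFE, H, hH, hH0, hx⟩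
    refine ⟨H * 1, by simpa using hH, by simpa using hH0, star.mem_star_div_mono hFE hx⟩
  · rintro ⟨H, hH, hH0, hx⟩
    exact ⟨E, hE, le_rfl, H, hH, hH0, hx⟩

theorem exists_of_fg_le_eabFun (star : SemistarOperation R K) {E F : Submodule R K} (hF : F.FG)
    (h : F ≤ star.eabFun E) : ∃ G : Submodule R K, G.FG ∧ G ≤ E ∧ ∃ H : Submodule R K, H.FG ∧
      H ≠ ⊥ ∧ F ≤ star (G * H) / star H := by
  induction F, hF using Submodule.fg_induction with
  | singleton x =>
    obtain ⟨G, hG, hGE, H, hH, hH0, hx⟩ := h (Submodule.mem_span_singleton_self x)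
    exact ⟨G, hG, hGE, H, hH, hH0, by rwa [Submodule.span_singleton_le_iff_mem]⟩
  | sup F₁ F₂ _ _ ih₁ ih₂ =>
    obtain ⟨G, hG, hGE, H, hH, hH0, hx⟩ := ih₁ (le_sup_left.trans h)
    obtain ⟨G', hG', hGE', H', hH', hH0', hx'⟩ := ih₂ (le_sup_right.trans h)
    refine ⟨G ⊔ G', hG.sup hG', sup_le hGE hGE', H * H', hH.mul hH', mul_ne_zero hH0 hH0',
      sup_le (fun x h1 => star.mem_star_div_mono le_sup_left (hx h1)) (fun x h1 => ?_)⟩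
    rw [mul_comm H H']
    exact star.mem_star_div_mono le_sup_right (hx' h1)

theorem smul_eabFun_le (star : SemistarOperation R K) (x : K) (E : Submodule R K) :
    x • star.eabFun E ≤ star.eabFun (x • E) := by
  rintro _ ⟨y, ⟨F, hF, hFE, H, hH, hH0, hy⟩, rfl⟩
  refine ⟨x • F, hF.map _, Submodule.map_mono hFE, H, hH, hH0, ?_⟩
  rw [mem_star_div] at hy ⊢
  intro z hz
  change x * y * z ∈ _
  rw [mul_assoc]
  refine star.smul_mem x (fun a ha => ?_) (hy z hz)
  induction ha using Submodule.mul_induction_on' with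
  | mem_mul_mem m hm n hn =>
    rw [← mul_assoc]
    exact Submodule.mul_mem_mul (Submodule.smul_mem_pointwise_smul m x F hm) hn
  | add a _ b _ h1 h2 => rw [mul_add]; exact Submodule.add_mem _ h1 h2

theorem eabFun_mono (star : SemistarOperation R K) {E F : Submodule R K} (h : E ≤ F) :
    star.eabFun E ≤ star.eabFun F := by
  rintro x ⟨G, hG, hGE, hx⟩
  exact ⟨G, hG, hGE.trans h, hx⟩

theorem le_eabFun (star : SemistarOperation R K) (E : Submodule R K) : E ≤ star.eabFun E := by
  intro x hx
  refine ⟨Submodule.span R {x}, Submodule.fg_span_singleton x,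
    (Submodule.span_singleton_le_iff_mem _ _).2 hx, 1, fg_one_submodule, one_ne_zero, ?_⟩
  rw [mem_star_div]
  intro y hy
  exact star.le_self _ (Submodule.mul_mem_mul (Submodule.mem_span_singleton_self x) hy)

/-- The semistar operation `⋆_a`, the e.a.b. semistar operation (of finite type) associated
to `⋆`. -/
def eab (star : SemistarOperation R K) : SemistarOperation R K where
  toFun := star.eabFun
  map_bot := by
    rw [eq_bot_iff]
    rintro x ⟨F, -, hF, H, -, hH0, hx⟩
    rw [le_bot_iff] at hF
    subst hF
    rw [mem_star_div] at hx
    obtain ⟨y, hy, hy0⟩ := Submodule.exists_mem_ne_zero_of_ne_bot hH0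
    have := hx y hy
    rw [Submodule.bot_mul, star.map_bot, Submodule.mem_bot] at this
    exact (Submodule.mem_bot R).2 ((mul_eq_zero.1 this).resolve_right hy0)
  map_smul := by
    intro x hx E
    refine le_antisymm ?_ (star.smul_eabFun_le x E)
    have h := star.smul_eabFun_le x⁻¹ (x • E)
    rw [smul_smul, inv_mul_cancel₀ hx, one_smul] at h
    intro y hy
    have h1 := h (Submodule.smul_mem_pointwise_smul y x⁻¹ _ hy)
    have h2 := Submodule.smul_mem_pointwise_smul _ x _ h1
    rwa [smul_smul, mul_inv_cancel₀ hx, one_smul] at h2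
  mono := fun _ _ h => star.eabFun_mono h
  le_self := star.le_eabFun
  idem := by
    intro E
    refine le_antisymm ?_ (star.le_eabFun _)
    rintro x ⟨F, hF, hFE, H, hH, hH0, hx⟩
    obtain ⟨G, hG, hGE, H', hH', hH0', hFG⟩ := star.exists_of_fg_le_eabFun hF hFE
    refine ⟨G, hG, hGE, H' * H, hH'.mul hH, mul_ne_zero hH0' hH0, ?_⟩
    have h1 := star.mem_star_div_mono (G := H') le_rfl hx
    rw [mul_comm H H'] at h1
    rw [mem_star_div] at h1 ⊢
    intro y hy
    have h2 : F * (H' * H) ≤ star (G * (H' * H)) := by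
      rw [← mul_assoc, ← mul_assoc]
      refine (mul_le_mul' ?_ le_rfl).trans (star.mul_star_le _ _)
      rw [Submodule.mul_le]
      intro m hm n hn
      exact (star.mem_star_div.1 (hFG hm)) n hn
    have h3 := star.mono _ _ h2 (h1 y hy)
    rwa [star.idem] at h3

end SemistarOperation

/-! ### The homogeneous quotient field and homogeneous submodules -/

section Graded

variable {R : Type*} [CommRing R] {Γ : Type*} [AddCancelCommMonoid Γ] [DecidableEq Γ]
  (𝒜 : Γ → AddSubgroup R) [GradedRing 𝒜]

/-- The multiplicative set `H` of nonzero homogeneous elements of the graded domain `R`. -/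
def nonzeroHomogeneous : Submonoid R :=
  SetLike.homogeneousSubmonoid 𝒜 ⊓ R⁰

variable (K : Type*) [Field K] [Algebra R K]

/-- The homogeneous quotient field `R_H` of `R`, as a subring of the quotient field `K`: the set
of all `a / s` with `a ∈ R` and `s ∈ H`. -/
noncomputable def homogeneousQuotientField [IsFractionRing R K] : Subalgebra R K :=
  Localization.subalgebra.ofField K (nonzeroHomogeneous 𝒜) inf_le_right

/-- The component `(R_H)_α`, for `α` in the quotient group `⟨Γ⟩` of `Γ`: zero, and all `a / s`
with `a ∈ R_β`, `0 ≠ s ∈ R_γ` and `β - γ = α`. -/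
def homogeneousComponent [IsDomain R] [IsFractionRing R K] (α : Algebra.GrothendieckAddGroup Γ) :
    AddSubgroup K where
  carrier := {x | x = 0 ∨ ∃ (β γ : Γ) (a s : R), a ∈ 𝒜 β ∧ s ∈ 𝒜 γ ∧ s ≠ 0 ∧
    Algebra.GrothendieckAddGroup.of β - Algebra.GrothendieckAddGroup.of γ = α ∧
    x = algebraMap R K a / algebraMap R K s}
  zero_mem' := Or.inl rfl
  add_mem' := by
    rintro x y (rfl | ⟨β, γ, a, s, ha, hs, hs0, h, rfl⟩) hy
    · rwa [zero_add]
    · rcases hy with rfl | ⟨β', γ', b, t, hb, ht, ht0, h', rfl⟩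
      · rw [add_zero]
        exact Or.inr ⟨β, γ, a, s, ha, hs, hs0, h, rfl⟩
      · have hs1 : algebraMap R K s ≠ 0 := by simpa using hs0
        have ht1 : algebraMap R K t ≠ 0 := by simpa using ht0
        have hdeg : β + γ' = γ + β' := by
          apply Algebra.GrothendieckAddGroup.of_injective
          rw [map_add, map_add, add_comm (Algebra.GrothendieckAddGroup.of γ),
            ← sub_eq_sub_iff_add_eq_add, h, h']
        refine Or.inr ⟨β + γ', γ + γ', a * t + s * b, s * t, add_mem (SetLike.mul_mem_graded ha ht)
          (hdeg ▸ SetLike.mul_mem_graded hs hb), SetLike.mul_mem_graded hs ht,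
          mul_ne_zero hs0 ht0, ?_, ?_⟩
        · rw [map_add, map_add, add_sub_add_right_eq_sub, h]
        · rw [map_add, map_mul, map_mul, map_mul, div_add_div _ _ hs1 ht1]
  neg_mem' := by
    rintro x (rfl | ⟨β, γ, a, s, ha, hs, hs0, h, rfl⟩)
    · exact Or.inl neg_zero
    · exact Or.inr ⟨β, γ, -a, s, neg_mem ha, hs, hs0, h, by rw [map_neg, neg_div]⟩

/-- An `R`-submodule `E` of `K` is homogeneous if `E = ⨁_α (E ∩ (R_H)_α)`, `α ∈ ⟨Γ⟩`; in particular
`E ⊆ R_H`. (`R_H` is the direct sum of its components, so that a sum of subgroups of the components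
is automatically direct, and `⨆` is this sum.) -/
def IsHomogeneousSubmodule [IsDomain R] [IsFractionRing R K] (E : Submodule R K) : Prop :=
  E.toAddSubgroup = ⨆ α : Algebra.GrothendieckAddGroup Γ,
    E.toAddSubgroup ⊓ homogeneousComponent 𝒜 K α

variable {K}

/-- A homogeneous fractional ideal of `R`: an `R`-submodule `E` of `K` such that `sE` is an integral
homogeneous ideal of `R` for some `s ∈ H`. -/
def IsHomogeneousFractionalIdeal (E : Submodule R K) : Prop :=
  ∃ s ∈ nonzeroHomogeneous 𝒜, ∃ J : Ideal R, J.IsHomogeneous 𝒜 ∧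
    algebraMap R K s • E = IsLocalization.coeSubmodule K J

/-- `⋆` is homogeneous preserving: it sends (nonzero) homogeneous fractional ideals of `R` to
homogeneous submodules of `R_H`. -/
def SemistarOperation.IsHomogeneousPreserving [IsDomain R] [IsFractionRing R K]
    (star : SemistarOperation R K) : Prop :=
  ∀ E : Submodule R K, E ≠ ⊥ → IsHomogeneousFractionalIdeal 𝒜 E →
    IsHomogeneousSubmodule 𝒜 K (star E)

/-! ### The Kronecker function ring -/

/-- `C(a)`, the ideal of `R` generated by the homogeneous components of `a`. -/
def homogeneousContent (a : R) : Ideal R :=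
  Ideal.span (Set.range fun α : Γ => (DirectSum.decompose 𝒜 a α : R))

/-- `𝒜_f = ∑ C(f_i)`, the homogeneous content ideal of the polynomial `f = ∑ f_i X^i`. -/
def polyContent (f : R[X]) : Ideal R :=
  ∑ i ∈ Finset.range (f.natDegree + 1), homogeneousContent 𝒜 (f.coeff i)

/-- The image of a polynomial over `R` in the field `K(X)`, the quotient field of `R[X]`. -/
noncomputable def toRatFunc (K : Type*) [Field K] [Algebra R K] (f : R[X]) : RatFunc K :=
  algebraMap K[X] (RatFunc K) (f.map (algebraMap R K))

/-- The set `Kr(R,⋆)` of all `f / g` with `f, g ∈ R[X]`, `g ≠ 0`, for which there is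
`0 ≠ h ∈ R[X]` with `𝒜_f 𝒜_h ⊆ (𝒜_g 𝒜_h)^⋆`. -/
def kronecker (star : SemistarOperation R K) : Set (RatFunc K) :=
  {φ | ∃ f g : R[X], g ≠ 0 ∧ φ = toRatFunc K f / toRatFunc K g ∧ ∃ h : R[X], h ≠ 0 ∧
    IsLocalization.coeSubmodule K (polyContent 𝒜 f * polyContent 𝒜 h) ≤
      star (IsLocalization.coeSubmodule K (polyContent 𝒜 g * polyContent 𝒜 h))}

/-- The extension `I S` of an ideal `I` of `R` to a subring `S` of `K(X)`: the `S`-submodule of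
`K(X)` generated by `I`. -/
noncomputable def extendIdeal (S : Subring (RatFunc K)) (I : Ideal R) :
    Submodule S (RatFunc K) :=
  Submodule.span S ((fun a : R => RatFunc.C (algebraMap R K a)) '' (I : Set R))

end Graded
end GradedKronecker

namespace GradedKronecker

/-! ### The Dedekind–Mertens inclusion over monoids with unique sums -/

/-! Everything rests on a Gauss-type lemma for homogeneous contents. Recording both the degree and
the power of X maps `R[X]` into the monoid algebra of `Γ × ℕ` over `R`, where `𝒜_f` becomes the
ideal generated by the coefficients. A torsion-free cancellative monoid has unique sums, and this is
enough for the Dedekind–Mertens inclusion `𝒜_f^(k+1) 𝒜_g ⊆ 𝒜_f^k 𝒜_(fg)` (`coeffIdeal_pow_mul_le`).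

If `⋆` is e.a.b., the power cancels and `𝒜_f 𝒜_g ⊆ (𝒜_(fg))^⋆`. Hence the fractions `f/g` with `𝒜_f
⊆ 𝒜_g^⋆` form a ring; it is Bézout because `x + y X^n` generates `(x, y)` for large `n`. A finitely
generated homogeneous ideal is `I = 𝒜_h` for some `h`, its extension is generated by `h`, and `a/s ∈
h Kr` amounts to `C(a) ⊆ (sI)^⋆`. So `I^⋆ = I Kr ∩ R_H` holds once `I^⋆ ⊆ R_H` and `(sI)^⋆` contains
the components of each of its elements `a ∈ R` (`star_eq_extendIdeal_inter`); homogeneous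
preservation gives both.

For (B), `⋆_a` is e.a.b., so the same construction applies to it. It has the same Kronecker ring: a
test module `H` can be scaled to an ideal of `R` and then, since homogeneous submodules contain
components, enlarged to a homogeneous content (`kronecker_eab`). The component condition for `⋆_a`
is a second use of Dedekind–Mertens. The inclusion `I^{⋆_a} ⊆ R_H` comes from complete integral
closedness: `x ∈ I^{⋆_a}` yields one `c ≠ 0` with `x^n c ∈ R_H` for all `n`. To conclude `x ∈ R_H`,
only finitely many degrees matter; they generate a free group of finite rank, and the corresponding
part of `R_H` is a Laurent polynomial ring over the field of degree-zero elements, where unique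
factorization applies. -/

theorem uniqueSums_of_isAddTorsionFree (M : Type*) [AddCancelCommMonoid M] [IsAddTorsionFree M] :
    UniqueSums M where
  uniqueAdd_of_nonempty {A B} hA hB := by
    classical
    -- Only sums of elements of `A ∪ B` matter, so `M` may be replaced by the finitely generated
    -- submonoid they generate. It is cancellative and torsion-free, hence affine, and affine
    -- monoids have unique sums.
    let N : AddSubmonoid M := AddSubmonoid.closure ((A ∪ B : Finset M) : Set M)
    have hAN : ∀ a ∈ A, a ∈ N := fun a ha =>
      AddSubmonoid.subset_closure (by simp [ha])
    have hBN : ∀ b ∈ B, b ∈ N := fun b hb =>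
      AddSubmonoid.subset_closure (by simp [hb])
    have : AddMonoid.FG N :=
      (AddMonoid.fg_iff_addSubmonoid_fg N).2 ⟨A ∪ B, rfl⟩
    have : IsAddTorsionFree N :=
      Function.Injective.isAddTorsionFree N.subtype Subtype.val_injective
    let _ : AddCancelCommMonoid N :=
      { (inferInstance : AddCommMonoid N) with
        add_left_cancel := fun x _ _ h => Subtype.ext (add_left_cancel (congrArg Subtype.val h)) }
    have : TwoUniqueSums N := AffineAddMonoid.to_twoUniqueSums
    obtain ⟨a, ha⟩ := hA
    obtain ⟨b, hb⟩ := hB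
    obtain ⟨a0, ha0, b0, hb0, h⟩ := UniqueSums.uniqueAdd_of_nonempty (G := N)
      (A := A.subtype (· ∈ N)) (B := B.subtype (· ∈ N))
      ⟨⟨a, hAN a ha⟩, by simpa using ha⟩ ⟨⟨b, hBN b hb⟩, by simpa using hb⟩
    refine ⟨a0, by simpa using ha0, b0, by simpa using hb0, fun x y hx hy hxy => ?_⟩
    have := @h ⟨x, hAN x hx⟩ ⟨y, hBN y hy⟩ (by simpa using hx) (by simpa using hy)
      (Subtype.ext hxy)
    simpa [Subtype.ext_iff] using this

section DedekindMertens

variable {R M : Type*} [CommRing R]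

/-- The ideal generated by the coefficients of an element of an additive monoid algebra. -/
def coeffIdeal (f : AddMonoidAlgebra R M) : Ideal R :=
  Ideal.span (Set.range fun m => f.coeff m)

theorem coeff_mem_coeffIdeal (f : AddMonoidAlgebra R M) (m : M) : f.coeff m ∈ coeffIdeal f :=
  Ideal.subset_span ⟨m, rfl⟩

theorem coeffIdeal_le {f : AddMonoidAlgebra R M} {I : Ideal R} :
    coeffIdeal f ≤ I ↔ ∀ m, f.coeff m ∈ I := by
  rw [coeffIdeal, Ideal.span_le]
  exact Set.range_subset_iff

theorem coeffIdeal_zero : coeffIdeal (0 : AddMonoidAlgebra R M) = ⊥ :=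
  le_bot_iff.1 (coeffIdeal_le.2 fun m => by simp)

theorem coeffIdeal_erase_le (f : AddMonoidAlgebra R M) (a : M) :
    coeffIdeal (f.erase a) ≤ coeffIdeal f := by
  classical
  rw [coeffIdeal_le]
  intro m
  rw [AddMonoidAlgebra.coeff_erase, Finsupp.erase_apply]
  split_ifs
  · exact zero_mem _
  · exact coeff_mem_coeffIdeal f m

theorem coeffIdeal_le_erase (f : AddMonoidAlgebra R M) (a : M) :
    coeffIdeal f ≤ Ideal.span {f.coeff a} ⊔ coeffIdeal (f.erase a) := by
  classical
  rw [coeffIdeal_le]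
  intro m
  by_cases h : m = a
  · subst h
    exact Ideal.mem_sup_left (Ideal.mem_span_singleton_self _)
  · have := coeff_mem_coeffIdeal (f.erase a) m
    rw [AddMonoidAlgebra.coeff_erase, Finsupp.erase_ne h] at this
    exact Ideal.mem_sup_right this

theorem coeffIdeal_sub_le (f g : AddMonoidAlgebra R M) :
    coeffIdeal (f - g) ≤ coeffIdeal f ⊔ coeffIdeal g := by
  rw [coeffIdeal_le]
  intro m
  rw [AddMonoidAlgebra.coeff_sub, Finsupp.sub_apply]
  exact sub_mem (Ideal.mem_sup_left (coeff_mem_coeffIdeal f m))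
    (Ideal.mem_sup_right (coeff_mem_coeffIdeal g m))

variable [AddCommMonoid M]

theorem coeffIdeal_single_mul_le (a : M) (r : R) (g : AddMonoidAlgebra R M) :
    coeffIdeal (AddMonoidAlgebra.single a r * g) ≤ Ideal.span {r} * coeffIdeal g := by
  classical
  rw [coeffIdeal_le]
  intro m
  rw [AddMonoidAlgebra.coeff_mul, AddMonoidAlgebra.coeff_single,
    Finsupp.sum_single_index (by simp [Finsupp.sum])]
  refine Ideal.sum_mem _ fun x _ => ?_
  dsimp only
  split_ifs
  · exact Ideal.mul_mem_mul (Ideal.mem_span_singleton_self r) (coeff_mem_coeffIdeal g x)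
  · exact zero_mem _

theorem coeffIdeal_erase_mul_le (f g : AddMonoidAlgebra R M) (a : M) :
    coeffIdeal (f.erase a * g) ≤ coeffIdeal (f * g) ⊔ Ideal.span {f.coeff a} * coeffIdeal g := by
  have h : f.erase a * g = f * g - AddMonoidAlgebra.single a (f.coeff a) * g := by
    rw [eq_sub_iff_add_eq, ← add_mul, AddMonoidAlgebra.erase_add_single]
  rw [h]
  exact (coeffIdeal_sub_le _ _).trans (sup_le_sup_left (coeffIdeal_single_mul_le _ _ _) _)

/-- A step of the Dedekind–Mertens induction, in terms of ideals: `A`, `B`, `C` are the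
coefficient ideals of `f`, `g`, `fg`, and `A'`, `B'`, `D`, `E` those of `f` and `g` without one
term each and of the corresponding products. -/
theorem dedekindMertens_step {A B C A' B' D E P Q : Ideal R} {k : ℕ}
    (hA : A ≤ P ⊔ A') (hA' : A' ≤ A) (hP : P ≤ A) (hB : B ≤ Q ⊔ B') (hQ : Q ≤ B)
    (hPQ : P * Q ≤ C)
    (hD : D ≤ C ⊔ P * B) (hE : E ≤ C ⊔ Q * A)
    (h1 : A ^ (k + 1) * B' ≤ A ^ k * E) (h2 : A' ^ (k + 2) * B ≤ A' ^ (k + 1) * D) :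
    A ^ (k + 2) * B ≤ A ^ (k + 1) * C := by
  have h1' : A ^ (k + 1) * B' ≤ A ^ k * (C ⊔ Q * A) := h1.trans (mul_le_mul' le_rfl hE)
  -- Terms with a factor `P` are absorbed first: the error term `Q * A` in the bound for `E` meets
  -- `P`, and `P * Q ≤ C`. Terms with a factor `Q` follow in `e6`.
  have e1 : P * (A ^ (k + 1) * B') ≤ A ^ (k + 1) * C := by
    calc P * (A ^ (k + 1) * B') ≤ P * (A ^ k * (C ⊔ Q * A)) := by gcongr
      _ = (P * A ^ k) * C ⊔ (P * Q) * A ^ (k + 1) := by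
        rw [Ideal.mul_sup, Ideal.mul_sup]; congr 1 <;> ring
      _ ≤ (A * A ^ k) * C ⊔ C * A ^ (k + 1) := by gcongr
      _ = A ^ (k + 1) * C := by rw [mul_comm C, pow_succ', sup_idem]
  have e2 : P * (A ^ (k + 1) * Q) ≤ A ^ (k + 1) * C := by
    calc P * (A ^ (k + 1) * Q) = A ^ (k + 1) * (P * Q) := by ring
      _ ≤ _ := by gcongr
  have e3 : P * (A ^ (k + 1) * B) ≤ A ^ (k + 1) * C := by
    calc P * (A ^ (k + 1) * B) ≤ P * (A ^ (k + 1) * (Q ⊔ B')) := by gcongr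
      _ = P * (A ^ (k + 1) * Q) ⊔ P * (A ^ (k + 1) * B') := by
        rw [Ideal.mul_sup, Ideal.mul_sup]
      _ ≤ _ := sup_le e2 e1
  have e4 : A' ^ (k + 2) * Q ≤ A ^ (k + 1) * C := by
    calc A' ^ (k + 2) * Q ≤ A' ^ (k + 2) * B := by gcongr
      _ ≤ A' ^ (k + 1) * (C ⊔ P * B) := h2.trans (by gcongr)
      _ ≤ A ^ (k + 1) * (C ⊔ P * B) := by gcongr
      _ = A ^ (k + 1) * C ⊔ P * (A ^ (k + 1) * B) := by
        rw [Ideal.mul_sup]; congr 1; ring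
      _ ≤ _ := sup_le le_rfl e3
  -- Modulo `P` the ideal `A` is contained in `A'`, so a power of `A` is a power of `A'` up to a
  -- multiple of `P`.
  have e5 : ∀ n, A ^ (n + 1) ≤ P * A ^ n ⊔ A' ^ (n + 1) := by
    intro n
    induction n with
    | zero => simpa using hA
    | succ n ih =>
      calc A ^ (n + 1 + 1) = A * A ^ (n + 1) := pow_succ' _ _
        _ ≤ (P ⊔ A') * A ^ (n + 1) := by gcongr
        _ = P * A ^ (n + 1) ⊔ A' * A ^ (n + 1) := Ideal.sup_mul _ _ _
        _ ≤ P * A ^ (n + 1) ⊔ A' * (P * A ^ n ⊔ A' ^ (n + 1)) := by gcongr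
        _ = P * A ^ (n + 1) ⊔ (P * (A' * A ^ n) ⊔ A' ^ (n + 1 + 1)) := by
          rw [Ideal.mul_sup, pow_succ' A' (n + 1)]; congr 2; ring
        _ ≤ P * A ^ (n + 1) ⊔ (P * (A * A ^ n) ⊔ A' ^ (n + 1 + 1)) := by gcongr
        _ = _ := by rw [← pow_succ', ← sup_assoc, sup_idem]
  have e6 : Q * A ^ (k + 2) ≤ A ^ (k + 1) * C := by
    calc Q * A ^ (k + 2) ≤ Q * (P * A ^ (k + 1) ⊔ A' ^ (k + 2)) := by gcongr; exact e5 (k + 1)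
      _ = P * (A ^ (k + 1) * Q) ⊔ A' ^ (k + 2) * Q := by
        rw [Ideal.mul_sup]; congr 1 <;> ring
      _ ≤ _ := sup_le e2 e4
  calc A ^ (k + 2) * B ≤ A ^ (k + 2) * (Q ⊔ B') := by gcongr
    _ = Q * A ^ (k + 2) ⊔ A * (A ^ (k + 1) * B') := by
      rw [Ideal.mul_sup]; congr 1 <;> ring
    _ ≤ A ^ (k + 1) * C ⊔ A * (A ^ k * (C ⊔ Q * A)) :=
      sup_le_sup e6 (by gcongr)
    _ = A ^ (k + 1) * C ⊔ (A ^ (k + 1) * C ⊔ Q * A ^ (k + 2)) := by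
      rw [Ideal.mul_sup, Ideal.mul_sup]; congr 2 <;> ring
    _ ≤ _ := sup_le le_rfl (sup_le le_rfl e6)

/-- Double induction, on a bound for the number of terms of `g` and, inside it, on the number of
terms of `f`. -/
theorem coeffIdeal_pow_mul_le [UniqueSums M] (k : ℕ) (f g : AddMonoidAlgebra R M)
    (hg : g.coeff.support.card ≤ k) :
    coeffIdeal f ^ (k + 1) * coeffIdeal g ≤ coeffIdeal f ^ k * coeffIdeal (f * g) := by
  classical
  induction k generalizing f g with
  | zero =>
    have : g = 0 := by simpa using hg
    subst this
    simp [coeffIdeal_zero]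
  | succ k ihk =>
    induction hn : f.coeff.support.card generalizing f with
    | zero =>
      have : f = 0 := by simpa using hn
      subst this
      simp [coeffIdeal_zero]
    | succ n ihn =>
      by_cases hg0 : g = 0
      · subst hg0
        simp [coeffIdeal_zero]
      have hf1 : f.coeff.support.Nonempty := Finset.card_pos.1 (by omega)
      have hg1 : g.coeff.support.Nonempty := by simpa [Finsupp.support_nonempty_iff] using hg0
      -- Uniqueness of the sum makes `f_a g_b` a coefficient of `f * g`. This plays the part of the
      -- product of leading coefficients, without any order on the monoid.
      obtain ⟨a, ha, b, hb, hu⟩ := UniqueSums.uniqueAdd_of_nonempty hf1 hg1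
      have hab := AddMonoidAlgebra.coeff_mul_add_of_uniqueAdd hu
      have hsf : (f.erase a).coeff.support.card = n := by
        rw [AddMonoidAlgebra.coeff_erase, Finsupp.support_erase, Finset.card_erase_of_mem ha]
        omega
      have hsg : (g.erase b).coeff.support.card ≤ k := by
        rw [AddMonoidAlgebra.coeff_erase, Finsupp.support_erase, Finset.card_erase_of_mem hb]
        omega
      have hE := coeffIdeal_erase_mul_le g f b
      rw [mul_comm g f, mul_comm _ f] at hE
      refine dedekindMertens_step (coeffIdeal_le_erase f a) (coeffIdeal_erase_le f a) ?_
        (coeffIdeal_le_erase g b) ?_ ?_ (coeffIdeal_erase_mul_le f g a) hE (ihk f _ hsg)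
        (ihn _ hsf)
      · rw [Ideal.span_singleton_le_iff_mem]
        exact coeff_mem_coeffIdeal f a
      · rw [Ideal.span_singleton_le_iff_mem]
        exact coeff_mem_coeffIdeal g b
      · rw [Ideal.span_singleton_mul_span_singleton, Ideal.span_singleton_le_iff_mem, ← hab]
        exact coeff_mem_coeffIdeal _ _

end DedekindMertens

section Content

variable {R : Type*} [CommRing R] {Γ : Type*} [AddCancelCommMonoid Γ] [DecidableEq Γ]
  (𝒜 : Γ → AddSubgroup R) [GradedRing 𝒜]

open DirectSum

/-! ### Homogeneous contents -/

/-- `Γ` is only a monoid, so a degree need not lie in `Γ + τ`. This covers the degrees missed by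
`coe_decompose_mul_add_of_right_mem`. -/
theorem coe_decompose_mul_eq_zero {b t : R} {τ δ : Γ} (ht : t ∈ 𝒜 τ) (h : ∀ γ, δ ≠ γ + τ) :
    (decompose 𝒜 (b * t) δ : R) = 0 := by
  induction b using Decomposition.inductionOn 𝒜 with
  | zero => simp
  | homogeneous m =>
    rename_i i
    exact decompose_of_mem_ne 𝒜 (SetLike.mul_mem_graded m.2 ht) (h i).symm
  | add m m' h1 h2 => rw [add_mul, decompose_add, DirectSum.add_apply, AddMemClass.coe_add, h1, h2, add_zero]

theorem homogeneousContent_le {a : R} {I : Ideal R} :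
    homogeneousContent 𝒜 a ≤ I ↔ ∀ γ, (decompose 𝒜 a γ : R) ∈ I := by
  rw [homogeneousContent, Ideal.span_le]
  exact Set.range_subset_iff

theorem decompose_mem_homogeneousContent (a : R) (γ : Γ) :
    (decompose 𝒜 a γ : R) ∈ homogeneousContent 𝒜 a :=
  Ideal.subset_span ⟨γ, rfl⟩

theorem mem_of_forall_decompose_mem {a : R} {I : Ideal R}
    (h : ∀ γ, (decompose 𝒜 a γ : R) ∈ I) : a ∈ I := by
  classical
  rw [← sum_support_decompose 𝒜 a]
  exact sum_mem fun γ _ => h γ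

theorem polyContent_le {f : R[X]} {I : Ideal R} :
    polyContent 𝒜 f ≤ I ↔ ∀ i γ, (decompose 𝒜 (f.coeff i) γ : R) ∈ I := by
  rw [polyContent, Ideal.sum_eq_sup, Finset.sup_le_iff]
  refine ⟨fun h i γ => ?_, fun h i _ => (homogeneousContent_le 𝒜).2 (h i)⟩
  by_cases hi : i ∈ Finset.range (f.natDegree + 1)
  · exact (homogeneousContent_le 𝒜).1 (h i hi) γ
  · rw [Polynomial.coeff_eq_zero_of_natDegree_lt (by simpa using hi)]
    simp

theorem decompose_coeff_mem_polyContent (f : R[X]) (i : ℕ) (γ : Γ) :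
    (decompose 𝒜 (f.coeff i) γ : R) ∈ polyContent 𝒜 f :=
  (polyContent_le 𝒜).1 le_rfl i γ

theorem coeff_mem_polyContent (f : R[X]) (i : ℕ) : f.coeff i ∈ polyContent 𝒜 f :=
  mem_of_forall_decompose_mem 𝒜 (decompose_coeff_mem_polyContent 𝒜 f i)

theorem polyContent_ne_bot {f : R[X]} (hf : f ≠ 0) : polyContent 𝒜 f ≠ ⊥ := by
  intro h
  apply hf
  ext i
  have := coeff_mem_polyContent 𝒜 f i
  rwa [h, Ideal.mem_bot] at this

theorem polyContent_zero : polyContent 𝒜 (0 : R[X]) = ⊥ :=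
  le_bot_iff.1 ((polyContent_le 𝒜).2 fun i γ => by simp)

theorem polyContent_C (a : R) : polyContent 𝒜 (Polynomial.C a) = homogeneousContent 𝒜 a := by
  refine le_antisymm ((polyContent_le 𝒜).2 fun i γ => ?_)
    ((homogeneousContent_le 𝒜).2 fun γ => ?_)
  · rw [Polynomial.coeff_C]
    split_ifs
    · exact decompose_mem_homogeneousContent 𝒜 a γ
    · simp
  · simpa using decompose_coeff_mem_polyContent 𝒜 (Polynomial.C a) 0 γ

theorem polyContent_one : polyContent 𝒜 (1 : R[X]) = ⊤ := by
  rw [Ideal.eq_top_iff_one]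
  simpa using coeff_mem_polyContent 𝒜 1 0

theorem polyContent_add_le (f g : R[X]) :
    polyContent 𝒜 (f + g) ≤ polyContent 𝒜 f ⊔ polyContent 𝒜 g := by
  refine (polyContent_le 𝒜).2 fun i γ => ?_
  rw [Polynomial.coeff_add, decompose_add, DirectSum.add_apply, AddMemClass.coe_add]
  exact add_mem (Ideal.mem_sup_left (decompose_coeff_mem_polyContent 𝒜 f i γ))
    (Ideal.mem_sup_right (decompose_coeff_mem_polyContent 𝒜 g i γ))

theorem polyContent_neg_le (f : R[X]) : polyContent 𝒜 (-f) ≤ polyContent 𝒜 f := by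
  refine (polyContent_le 𝒜).2 fun i γ => ?_
  rw [Polynomial.coeff_neg, decompose_neg, DFinsupp.neg_apply, NegMemClass.coe_neg]
  exact neg_mem (decompose_coeff_mem_polyContent 𝒜 f i γ)

/-- The shift by `n` keeps the coefficients of `f` and `g` apart, so none are lost by cancellation.
-/
theorem polyContent_le_add_mul_X_pow {f g : R[X]} {n : ℕ} (hn : f.natDegree < n) :
    polyContent 𝒜 f ⊔ polyContent 𝒜 g ≤ polyContent 𝒜 (f + g * Polynomial.X ^ n) := by
  refine sup_le ((polyContent_le 𝒜).2 fun i γ => ?_) ((polyContent_le 𝒜).2 fun i γ => ?_)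
  · by_cases hi : i < n
    · have := decompose_coeff_mem_polyContent 𝒜 (f + g * Polynomial.X ^ n) i γ
      rwa [Polynomial.coeff_add, Polynomial.coeff_mul_X_pow', if_neg (by omega), add_zero] at this
    · rw [Polynomial.coeff_eq_zero_of_natDegree_lt (by omega)]
      simp
  · have := decompose_coeff_mem_polyContent 𝒜 (f + g * Polynomial.X ^ n) (i + n) γ
    rwa [Polynomial.coeff_add, Polynomial.coeff_mul_X_pow,
      Polynomial.coeff_eq_zero_of_natDegree_lt (by omega), zero_add] at this

/-- Multiplication by a homogeneous `s` only shifts degrees: the component of `s f_i` in degree `γ +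
σ` is `s` times that of `f_i` in degree `γ`. -/
theorem span_singleton_mul_polyContent_le {s : R} {σ : Γ} (hs : s ∈ 𝒜 σ) (f : R[X]) :
    Ideal.span {s} * polyContent 𝒜 f ≤ polyContent 𝒜 (Polynomial.C s * f) := by
  rw [Ideal.mul_le]
  intro r hr x hx
  obtain ⟨r, rfl⟩ := Ideal.mem_span_singleton'.1 hr
  rw [mul_assoc]
  refine Ideal.mul_mem_left _ _ ?_
  suffices h : polyContent 𝒜 f ≤ Submodule.comap (LinearMap.mulLeft R s)
      (polyContent 𝒜 (Polynomial.C s * f)) from h hx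
  refine (polyContent_le 𝒜).2 fun i γ => ?_
  have := decompose_coeff_mem_polyContent 𝒜 (Polynomial.C s * f) i (γ + σ)
  rw [Polynomial.coeff_C_mul, mul_comm s, coe_decompose_mul_add_of_right_mem 𝒜 hs] at this
  rw [Submodule.mem_comap, LinearMap.mulLeft_apply, mul_comm s]
  exact this

theorem fg_homogeneousContent (a : R) : (homogeneousContent 𝒜 a).FG := by
  classical
  refine ⟨(decompose 𝒜 a).support.image fun γ => (decompose 𝒜 a γ : R), le_antisymm ?_ ?_⟩
  · refine Ideal.span_le.2 fun x hx => ?_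
    obtain ⟨γ, -, rfl⟩ := Finset.mem_image.1 hx
    exact decompose_mem_homogeneousContent 𝒜 a γ
  · refine (homogeneousContent_le 𝒜).2 fun γ => ?_
    by_cases h : γ ∈ (decompose 𝒜 a).support
    · exact Submodule.subset_span (Finset.mem_image_of_mem _ h)
    · rw [DFinsupp.notMem_support_iff.1 h]
      exact zero_mem _

theorem fg_polyContent (f : R[X]) : (polyContent 𝒜 f).FG := by
  rw [polyContent, Ideal.sum_eq_sup]
  exact Submodule.fg_finset_sup _ _ fun i _ => fg_homogeneousContent 𝒜 _

theorem isHomogeneous_homogeneousContent (a : R) :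
    (homogeneousContent 𝒜 a).IsHomogeneous 𝒜 := by
  refine Ideal.homogeneous_span 𝒜 _ ?_
  rintro _ ⟨γ, rfl⟩
  exact ⟨γ, (decompose 𝒜 a γ).2⟩

theorem isHomogeneous_polyContent (f : R[X]) : (polyContent 𝒜 f).IsHomogeneous 𝒜 := by
  rw [polyContent]
  exact Finset.sum_induction _ (fun I : Ideal R => I.IsHomogeneous 𝒜)
    (fun _ _ h1 h2 => h1.sup h2) (Ideal.IsHomogeneous.bot 𝒜)
    fun i _ => isHomogeneous_homogeneousContent 𝒜 _

theorem exists_coeff_eq_of_fg {I : Ideal R} (hI : I.FG) :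
    ∃ h : R[X], I = Ideal.span (Set.range h.coeff) := by
  obtain ⟨n, r, rfl⟩ := Submodule.fg_iff_exists_fin_generating_family.1 hI
  refine ⟨∑ i : Fin n, Polynomial.monomial i (r i), ?_⟩
  have hc : ∀ j, (∑ i : Fin n, Polynomial.monomial (i : ℕ) (r i)).coeff j =
      if hj : j < n then r ⟨j, hj⟩ else 0 := by
    intro j
    rw [Polynomial.finsetSum_coeff]
    split_ifs with hj
    · rw [Finset.sum_eq_single ⟨j, hj⟩]
      · simp
      · intro i _ hi
        exact Polynomial.coeff_monomial_of_ne _ fun h => hi (Fin.ext h.symm)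
      · simp
    · refine Finset.sum_eq_zero fun i _ => Polynomial.coeff_monomial_of_ne _ ?_
      have := i.2
      omega
  refine le_antisymm (Ideal.span_le.2 ?_) (Ideal.span_le.2 ?_)
  · rintro _ ⟨i, rfl⟩
    exact Ideal.subset_span ⟨i, by rw [hc, dif_pos i.2]⟩
  · rintro _ ⟨j, rfl⟩
    rw [hc]
    split_ifs with hj
    · exact Submodule.subset_span ⟨_, rfl⟩
    · exact zero_mem _

theorem polyContent_eq_of_isHomogeneous {I : Ideal R} (hI : I.IsHomogeneous 𝒜) {h : R[X]}
    (hh : I = Ideal.span (Set.range h.coeff)) : polyContent 𝒜 h = I := by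
  refine le_antisymm ((polyContent_le 𝒜).2 fun i γ => hI γ ?_) ?_
  · rw [hh]
    exact Ideal.subset_span ⟨i, rfl⟩
  · rw [hh, Ideal.span_le]
    rintro _ ⟨i, rfl⟩
    exact coeff_mem_polyContent 𝒜 h i

/-- This passes between ideals and polynomials: a product of contents is again a content, and every
finitely generated homogeneous `I` has a polynomial that generates its extension. -/
theorem exists_polyContent_eq {I : Ideal R} (hI : I.IsHomogeneous 𝒜) (hfg : I.FG) :
    ∃ h : R[X], polyContent 𝒜 h = I := by
  obtain ⟨h, hh⟩ := exists_coeff_eq_of_fg hfg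
  exact ⟨h, polyContent_eq_of_isHomogeneous 𝒜 hI hh⟩

theorem span_coeff_le_polyContent (h : R[X]) :
    Ideal.span (Set.range h.coeff) ≤ polyContent 𝒜 h := by
  rw [Ideal.span_le]
  rintro _ ⟨i, rfl⟩
  exact coeff_mem_polyContent 𝒜 h i

/-! ### Contents of products -/

/-- The ring homomorphism which sends `r ∈ 𝒜 γ` to `r T^(γ, 0)`. -/
noncomputable def splitRingHom : R →+* AddMonoidAlgebra R (Γ × ℕ) :=
  (DirectSum.toSemiring (fun γ => (AddMonoidAlgebra.singleAddHom (γ, 0)).comp (𝒜 γ).subtype)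
    rfl (fun _ _ => by simp [AddMonoidAlgebra.single_mul_single])).comp
    (decomposeRingEquiv 𝒜 : R →+* ⨁ γ, 𝒜 γ)

theorem splitRingHom_of_mem {r : R} {γ : Γ} (hr : r ∈ 𝒜 γ) :
    splitRingHom 𝒜 r = AddMonoidAlgebra.single (γ, 0) r := by
  have : decomposeRingEquiv 𝒜 r = DirectSum.of (fun γ => 𝒜 γ) γ ⟨r, hr⟩ :=
    decompose_of_mem 𝒜 hr
  rw [splitRingHom, RingHom.comp_apply, RingHom.coe_coe, this]
  exact DirectSum.toSemiring_of _ _ _ _ _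

/-- The ring homomorphism which sends `r X^i` with `r ∈ 𝒜 γ` to `r T^(γ, i)`. -/
noncomputable def splitPolyRingHom : R[X] →+* AddMonoidAlgebra R (Γ × ℕ) :=
  Polynomial.eval₂RingHom (splitRingHom 𝒜) (AddMonoidAlgebra.single (0, 1) 1)

theorem coeff_splitPolyRingHom (f : R[X]) (γ : Γ) (i : ℕ) :
    (splitPolyRingHom 𝒜 f).coeff (γ, i) = decompose 𝒜 (f.coeff i) γ := by
  induction f using Polynomial.induction_on' with
  | add p q hp hq => simp [hp, hq]
  | monomial n a =>
    induction a using Decomposition.inductionOn 𝒜 with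
    | zero => simp
    | add m m' h1 h2 =>
      rw [map_add, map_add, AddMonoidAlgebra.coeff_add, Finsupp.add_apply, h1, h2]
      simp
    | homogeneous m =>
      rename_i δ
      have : splitPolyRingHom 𝒜 (Polynomial.monomial n (m : R)) =
          AddMonoidAlgebra.single (δ, n) (m : R) := by
        rw [splitPolyRingHom, Polynomial.coe_eval₂RingHom, Polynomial.eval₂_monomial,
          splitRingHom_of_mem 𝒜 m.2, AddMonoidAlgebra.single_pow,
          AddMonoidAlgebra.single_mul_single]
        simp
      rw [this, AddMonoidAlgebra.coeff_single, Finsupp.single_apply, Polynomial.coeff_monomial]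
      by_cases hn : n = i
      · by_cases hd : δ = γ
        · subst hn hd
          simp
        · rw [if_neg (by simp [hd]), if_pos hn, decompose_of_mem_ne 𝒜 m.2 hd]
      · simp [hn]

theorem coeffIdeal_splitPolyRingHom (f : R[X]) :
    coeffIdeal (splitPolyRingHom 𝒜 f) = polyContent 𝒜 f := by
  refine le_antisymm (coeffIdeal_le.2 fun ⟨γ, i⟩ => ?_) ((polyContent_le 𝒜).2 fun i γ => ?_)
  · rw [coeff_splitPolyRingHom]
    exact decompose_coeff_mem_polyContent 𝒜 f i γ
  · rw [← coeff_splitPolyRingHom]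
    exact coeff_mem_coeffIdeal _ _

theorem polyContent_mul_le (f g : R[X]) :
    polyContent 𝒜 (f * g) ≤ polyContent 𝒜 f * polyContent 𝒜 g := by
  classical
  rw [← coeffIdeal_splitPolyRingHom, ← coeffIdeal_splitPolyRingHom, ← coeffIdeal_splitPolyRingHom,
    map_mul, coeffIdeal_le]
  intro m
  rw [AddMonoidAlgebra.coeff_mul]
  refine Ideal.sum_mem _ fun a _ => Ideal.sum_mem _ fun b _ => ?_
  dsimp only
  split_ifs
  · exact Ideal.mul_mem_mul (coeff_mem_coeffIdeal _ _) (coeff_mem_coeffIdeal _ _)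
  · exact zero_mem _

/-- The Dedekind–Mertens inclusion for homogeneous contents. -/
theorem exists_polyContent_pow_mul_le [IsAddTorsionFree Γ] (f g : R[X]) :
    ∃ k, polyContent 𝒜 f ^ (k + 1) * polyContent 𝒜 g ≤
      polyContent 𝒜 f ^ k * polyContent 𝒜 (f * g) := by
  have := uniqueSums_of_isAddTorsionFree Γ
  -- The exponent is the number of terms of `g`, counted as pairs of a degree in `Γ` and a power of
  -- X.
  refine ⟨(splitPolyRingHom 𝒜 g).coeff.support.card, ?_⟩
  rw [← coeffIdeal_splitPolyRingHom, ← coeffIdeal_splitPolyRingHom, ← coeffIdeal_splitPolyRingHom,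
    map_mul]
  exact coeffIdeal_pow_mul_le _ _ _ le_rfl

end Content

open IsLocalization (coeSubmodule)

/-! ### Semistar operations and products -/

namespace SemistarOperation

variable {R K : Type*} [CommRing R] [Field K] [Algebra R K]

theorem le_star_of_le_star (star : SemistarOperation R K) {A B C : Submodule R K}
    (h1 : A ≤ star B) (h2 : B ≤ star C) : A ≤ star C := by
  have := star.mono _ _ h2
  rw [star.idem] at this
  exact h1.trans this

theorem mul_le_star_mul (star : SemistarOperation R K) {A B C D : Submodule R K}
    (h1 : A ≤ star B) (h2 : C ≤ star D) : A * C ≤ star (B * D) := by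
  refine star.le_star_of_le_star ((mul_le_mul' h1 le_rfl).trans (star.mul_star_le B C)) ?_
  rw [mul_comm B C, mul_comm B D]
  exact (mul_le_mul' h2 le_rfl).trans (star.mul_star_le D B)

/-- The cancellation law in the form used throughout: no `⋆` on the left, and `F = 0` allowed. -/
theorem IsEAB.le_star_of_mul_le {star : SemistarOperation R K} (hs : star.IsEAB)
    {E F G : Submodule R K} (hE : E.FG) (hE0 : E ≠ ⊥) (hF : F.FG) (hG : G.FG) (hG0 : G ≠ ⊥)
    (h : E * F ≤ star (E * G)) : F ≤ star G := by
  rcases eq_or_ne F ⊥ with rfl | hF0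
  · exact bot_le
  · exact (star.le_self F).trans (hs E F G hE hE0 hF hF0 hG hG0
      (star.le_star_of_le_star le_rfl h))

theorem le_div_star_iff (star : SemistarOperation R K) {A B H : Submodule R K} :
    B ≤ star A / star H ↔ B * H ≤ star A := by
  rw [Submodule.mul_le]
  exact forall₂_congr fun x _ => star.mem_star_div

/-- A single test module `H` serves all of `F`: test modules for finitely many generators are
multiplied together. -/
theorem le_eab_iff (star : SemistarOperation R K) {E F : Submodule R K} (hE : E.FG)
    (hF : F.FG) : F ≤ star.eab E ↔
      ∃ H : Submodule R K, H.FG ∧ H ≠ ⊥ ∧ F * H ≤ star (E * H) := by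
  constructor
  · intro h
    obtain ⟨G, -, hGE, H, hH, hH0, hFG⟩ := star.exists_of_fg_le_eabFun hF h
    exact ⟨H, hH, hH0, (star.le_div_star_iff.1 hFG).trans
      (star.mono _ _ (mul_le_mul' hGE le_rfl))⟩
  · rintro ⟨H, hH, hH0, hFH⟩ x hx
    exact (star.mem_eabFun_of_fg hE).2 ⟨H, hH, hH0, star.le_div_star_iff.2 hFH hx⟩

theorem isEAB_eab (star : SemistarOperation R K) : star.eab.IsEAB := by
  intro E F G hE hE0 hF hF0 hG hG0 h
  refine star.eab.le_star_of_le_star le_rfl ?_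
  obtain ⟨H, hH, hH0, h1⟩ := (star.le_eab_iff (hE.mul hG) (hE.mul hF)).1
    ((star.eab.le_self _).trans h)
  -- If `H` tests `E * F` against `E * G`, then `E * H` tests `F` against `G`.
  refine (star.le_eab_iff hG hF).2 ⟨E * H, hE.mul hH, mul_ne_zero hE0 hH0, ?_⟩
  rwa [mul_left_comm, ← mul_assoc, mul_left_comm, ← mul_assoc]

theorem le_eab_of_le_star (star : SemistarOperation R K) {E F : Submodule R K} (hE : E.FG)
    (hF : F.FG) (h : F ≤ star E) : F ≤ star.eab E :=
  (star.le_eab_iff hE hF).2 ⟨1, fg_one_submodule, one_ne_zero, by simpa using h⟩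

end SemistarOperation

section

variable {R : Type*} [CommRing R] (K : Type*) [Field K] [Algebra R K]

/-! ### Fractions of polynomials -/

theorem toRatFunc_add (f g : R[X]) : toRatFunc K (f + g) = toRatFunc K f + toRatFunc K g := by
  simp [toRatFunc]

theorem toRatFunc_mul (f g : R[X]) : toRatFunc K (f * g) = toRatFunc K f * toRatFunc K g := by
  simp [toRatFunc]

theorem toRatFunc_neg (f : R[X]) : toRatFunc K (-f) = -toRatFunc K f := by
  simp [toRatFunc]

theorem toRatFunc_C (a : R) : toRatFunc K (Polynomial.C a) = RatFunc.C (algebraMap R K a) := by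
  simp [toRatFunc]

theorem toRatFunc_one : toRatFunc K (1 : R[X]) = 1 := by
  simp [toRatFunc]

theorem toRatFunc_zero : toRatFunc K (0 : R[X]) = 0 := by
  simp [toRatFunc]

theorem toRatFunc_X : toRatFunc K (Polynomial.X : R[X]) = RatFunc.X := by
  simp [toRatFunc]

theorem toRatFunc_eq_sum (f : R[X]) : toRatFunc K f =
    ∑ i ∈ Finset.range (f.natDegree + 1),
      RatFunc.C (algebraMap R K (f.coeff i)) * RatFunc.X ^ i := by
  conv_lhs => rw [f.as_sum_range_C_mul_X_pow]
  simp [toRatFunc, Polynomial.map_sum]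

variable [IsFractionRing R K]

theorem toRatFunc_injective : Function.Injective (toRatFunc K : R[X] → RatFunc K) :=
  (RatFunc.algebraMap_injective K).comp
    (Polynomial.map_injective _ (IsFractionRing.injective R K))

theorem toRatFunc_ne_zero {f : R[X]} (hf : f ≠ 0) : toRatFunc K f ≠ 0 := by
  rw [← toRatFunc_zero (R := R) K]
  exact (toRatFunc_injective K).ne hf

end

section Kronecker

variable {R : Type*} [CommRing R] {Γ : Type*} [AddCancelCommMonoid Γ] [DecidableEq Γ]
  (𝒜 : Γ → AddSubgroup R) [GradedRing 𝒜] (K : Type*) [Field K] [Algebra R K]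

theorem toRatFunc_mem_extendIdeal {K : Type*} [Field K] [Algebra R K] {S : Subring (RatFunc K)} (hX : RatFunc.X ∈ S) {I : Ideal R}
    {h : R[X]} (hh : ∀ i, h.coeff i ∈ I) : toRatFunc K h ∈ extendIdeal S I := by
  rw [toRatFunc_eq_sum]
  refine sum_mem fun i _ => ?_
  rw [mul_comm]
  exact Submodule.smul_mem _ (⟨RatFunc.X ^ i, pow_mem hX i⟩ : S)
    (Submodule.subset_span ⟨_, hh i, rfl⟩)

/-! ### Contents in the quotient field -/

/-- The content of a polynomial as a submodule of `K`. -/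
def fieldContent (f : R[X]) : Submodule R K :=
  coeSubmodule K (polyContent 𝒜 f)

theorem fg_fieldContent (f : R[X]) : (fieldContent 𝒜 K f).FG :=
  Submodule.FG.map (Algebra.linearMap R K) (fg_polyContent 𝒜 f)

theorem fieldContent_zero : fieldContent 𝒜 K (0 : R[X]) = ⊥ := by
  rw [fieldContent, polyContent_zero, IsLocalization.coeSubmodule_bot]

theorem fieldContent_one : fieldContent 𝒜 K (1 : R[X]) = 1 := by
  rw [fieldContent, polyContent_one, IsLocalization.coeSubmodule_top]

theorem fieldContent_le_one (f : R[X]) : fieldContent 𝒜 K f ≤ 1 := by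
  rw [← IsLocalization.coeSubmodule_top]
  exact IsLocalization.coeSubmodule_mono K le_top

theorem fieldContent_mul_le (f g : R[X]) :
    fieldContent 𝒜 K (f * g) ≤ fieldContent 𝒜 K f * fieldContent 𝒜 K g := by
  rw [fieldContent, fieldContent, fieldContent, ← IsLocalization.coeSubmodule_mul]
  exact IsLocalization.coeSubmodule_mono K (polyContent_mul_le 𝒜 f g)

theorem fieldContent_add_le (f g : R[X]) :
    fieldContent 𝒜 K (f + g) ≤ fieldContent 𝒜 K f ⊔ fieldContent 𝒜 K g := by
  rw [fieldContent, fieldContent, fieldContent, ← IsLocalization.coeSubmodule_sup]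
  exact IsLocalization.coeSubmodule_mono K (polyContent_add_le 𝒜 f g)

theorem exists_fieldContent_pow_mul_le [IsAddTorsionFree Γ] (f g : R[X]) :
    ∃ k, fieldContent 𝒜 K f ^ k * (fieldContent 𝒜 K f * fieldContent 𝒜 K g) ≤
      fieldContent 𝒜 K f ^ k * fieldContent 𝒜 K (f * g) := by
  obtain ⟨k, hk⟩ := exists_polyContent_pow_mul_le 𝒜 f g
  refine ⟨k, ?_⟩
  rw [pow_succ, mul_assoc] at hk
  have := IsLocalization.coeSubmodule_mono K hk
  have hpow : ∀ I : Ideal R, coeSubmodule K (I ^ k) = coeSubmodule K I ^ k := fun I =>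
    Submodule.map_pow I (Algebra.ofId R K) k
  simpa only [IsLocalization.coeSubmodule_mul, hpow, fieldContent] using this

variable [IsFractionRing R K]

theorem coeSubmodule_ne_bot {I : Ideal R} (hI : I ≠ ⊥) : coeSubmodule K I ≠ ⊥ := by
  rw [← IsLocalization.coeSubmodule_bot]
  exact (IsFractionRing.coeSubmodule_injective R K).ne hI

theorem fieldContent_ne_bot {f : R[X]} (hf : f ≠ 0) : fieldContent 𝒜 K f ≠ ⊥ :=
  coeSubmodule_ne_bot K (polyContent_ne_bot 𝒜 hf)

variable {K} {star : SemistarOperation R K}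

theorem mem_homogeneousQuotientField {x : K} : x ∈ homogeneousQuotientField 𝒜 K ↔
    ∃ a s : R, s ∈ nonzeroHomogeneous 𝒜 ∧ x = algebraMap R K a / algebraMap R K s := by
  simp only [div_eq_mul_inv]
  constructor
  · rintro ⟨a, s, hs, rfl⟩
    exact ⟨a, s, hs, rfl⟩
  · rintro ⟨a, s, hs, rfl⟩
    exact ⟨a, s, hs, rfl⟩

theorem star_coeSubmodule_span_singleton_mul {s : R} (hs0 : s ≠ 0) (I : Ideal R) :
    star (coeSubmodule K (Ideal.span {s} * I)) = algebraMap R K s • star (coeSubmodule K I) := by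
  have hs1 : algebraMap R K s ≠ 0 := by simpa using hs0
  rw [← star.map_smul _ hs1, IsLocalization.coeSubmodule_mul,
    IsLocalization.coeSubmodule_span_singleton]
  congr 1
  ext x
  rw [Submodule.mem_span_singleton_mul, Submodule.mem_smul_pointwise_iff_exists]
  rfl

variable [IsDomain R]

theorem SemistarOperation.IsEAB.mem_kronecker_iff (hs : star.IsEAB) {φ : RatFunc K} :
    φ ∈ kronecker 𝒜 star ↔ ∃ f g : R[X], g ≠ 0 ∧ φ = toRatFunc K f / toRatFunc K g ∧
      fieldContent 𝒜 K f ≤ star (fieldContent 𝒜 K g) := by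
  constructor
  · rintro ⟨f, g, hg, rfl, h, hh, hfg⟩
    rw [IsLocalization.coeSubmodule_mul, IsLocalization.coeSubmodule_mul, mul_comm,
      mul_comm (coeSubmodule K (polyContent 𝒜 g))] at hfg
    exact ⟨f, g, hg, rfl, hs.le_star_of_mul_le (fg_fieldContent 𝒜 K h)
      (fieldContent_ne_bot 𝒜 K hh) (fg_fieldContent 𝒜 K f) (fg_fieldContent 𝒜 K g)
      (fieldContent_ne_bot 𝒜 K hg) hfg⟩
  · rintro ⟨f, g, hg, rfl, hfg⟩
    refine ⟨f, g, hg, rfl, 1, one_ne_zero, ?_⟩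
    rw [polyContent_one, Ideal.mul_top, Ideal.mul_top]
    exact hfg

variable [IsAddTorsionFree Γ]

/-- The Gauss lemma up to `⋆`: the power of `𝒜_f` in the Dedekind–Mertens inclusion is cancelled. It
makes denominators multiply correctly in the Kronecker ring. -/
theorem SemistarOperation.IsEAB.fieldContent_mul_le_star (hs : star.IsEAB) (f g : R[X]) :
    fieldContent 𝒜 K f * fieldContent 𝒜 K g ≤ star (fieldContent 𝒜 K (f * g)) := by
  rcases eq_or_ne f 0 with rfl | hf
  · rw [fieldContent_zero, Submodule.bot_mul]
    exact bot_le
  rcases eq_or_ne g 0 with rfl | hg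
  · rw [fieldContent_zero, Submodule.mul_bot]
    exact bot_le
  obtain ⟨k, hk⟩ := exists_fieldContent_pow_mul_le 𝒜 K f g
  exact hs.le_star_of_mul_le ((fg_fieldContent 𝒜 K f).pow k)
    (pow_ne_zero k (fieldContent_ne_bot 𝒜 K hf))
    ((fg_fieldContent 𝒜 K f).mul (fg_fieldContent 𝒜 K g)) (fg_fieldContent 𝒜 K _)
    (fieldContent_ne_bot 𝒜 K (mul_ne_zero hf hg)) (hk.trans (star.le_self _))

/-! ### The Kronecker function ring of an e.a.b. operation -/

/-- The Kronecker function ring of an e.a.b. semistar operation. -/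
def kroneckerSubring (hs : star.IsEAB) : Subring (RatFunc K) where
  carrier := kronecker 𝒜 star
  zero_mem' := (hs.mem_kronecker_iff 𝒜).2 ⟨0, 1, one_ne_zero, by simp [toRatFunc_zero], by
    rw [fieldContent_zero]
    exact bot_le⟩
  one_mem' := (hs.mem_kronecker_iff 𝒜).2 ⟨1, 1, one_ne_zero, by simp [toRatFunc_one],
    star.le_self _⟩
  mul_mem' := by
    intro φ ψ hφ hψ
    obtain ⟨f, g, hg, rfl, hfg⟩ := (hs.mem_kronecker_iff 𝒜).1 hφ
    obtain ⟨f', g', hg', rfl, hfg'⟩ := (hs.mem_kronecker_iff 𝒜).1 hψ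
    refine (hs.mem_kronecker_iff 𝒜).2 ⟨f * f', g * g', mul_ne_zero hg hg', ?_, ?_⟩
    · rw [toRatFunc_mul, toRatFunc_mul, div_mul_div_comm]
    · exact star.le_star_of_le_star ((fieldContent_mul_le 𝒜 K f f').trans
        (star.mul_le_star_mul hfg hfg')) (hs.fieldContent_mul_le_star 𝒜 g g')
  add_mem' := by
    intro φ ψ hφ hψ
    obtain ⟨f, g, hg, rfl, hfg⟩ := (hs.mem_kronecker_iff 𝒜).1 hφ
    obtain ⟨f', g', hg', rfl, hfg'⟩ := (hs.mem_kronecker_iff 𝒜).1 hψ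
    refine (hs.mem_kronecker_iff 𝒜).2 ⟨f * g' + g * f', g * g', mul_ne_zero hg hg', ?_, ?_⟩
    · rw [toRatFunc_add, toRatFunc_mul, toRatFunc_mul, toRatFunc_mul,
        div_add_div _ _ (toRatFunc_ne_zero K hg) (toRatFunc_ne_zero K hg')]
    · refine star.le_star_of_le_star ((fieldContent_add_le 𝒜 K _ _).trans (sup_le
        ((fieldContent_mul_le 𝒜 K f g').trans (star.mul_le_star_mul hfg (star.le_self _)))
        ((fieldContent_mul_le 𝒜 K g f').trans (star.mul_le_star_mul (star.le_self _) hfg'))))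
        (hs.fieldContent_mul_le_star 𝒜 g g')
  neg_mem' := by
    intro φ hφ
    obtain ⟨f, g, hg, rfl, hfg⟩ := (hs.mem_kronecker_iff 𝒜).1 hφ
    refine (hs.mem_kronecker_iff 𝒜).2 ⟨-f, g, hg, by rw [toRatFunc_neg, neg_div], ?_⟩
    exact (IsLocalization.coeSubmodule_mono K (polyContent_neg_le 𝒜 f)).trans hfg

variable (hs : star.IsEAB)

theorem div_mem_kroneckerSubring {f g : R[X]} (hg : g ≠ 0)
    (h : fieldContent 𝒜 K f ≤ star (fieldContent 𝒜 K g)) :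
    toRatFunc K f / toRatFunc K g ∈ kroneckerSubring 𝒜 hs :=
  (hs.mem_kronecker_iff 𝒜).2 ⟨f, g, hg, rfl, h⟩

theorem toRatFunc_mem_kroneckerSubring (f : R[X]) : toRatFunc K f ∈ kroneckerSubring 𝒜 hs := by
  have := div_mem_kroneckerSubring 𝒜 hs (f := f) (g := 1) one_ne_zero (by
    rw [fieldContent_one]
    exact (fieldContent_le_one 𝒜 K f).trans (star.le_self _))
  rwa [toRatFunc_one, div_one] at this

theorem X_mem_kroneckerSubring : (RatFunc.X : RatFunc K) ∈ kroneckerSubring 𝒜 hs := by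
  rw [← toRatFunc_X (R := R)]
  exact toRatFunc_mem_kroneckerSubring 𝒜 hs _

/-- The element `x + y X^n` generates the ideal `(x, y)`. Over a common denominator its numerator
has a content containing those of the numerators of `x` and `y`, so both quotients lie in the ring.
-/
theorem exists_eq_mul_kroneckerSubring (x y : kroneckerSubring 𝒜 hs) :
    ∃ n : ℕ, ∃ a b : kroneckerSubring 𝒜 hs,
      x = a * (x + y * ⟨RatFunc.X, X_mem_kroneckerSubring 𝒜 hs⟩ ^ n) ∧
      y = b * (x + y * ⟨RatFunc.X, X_mem_kroneckerSubring 𝒜 hs⟩ ^ n) := by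
  obtain ⟨x, hx⟩ := x
  obtain ⟨y, hy⟩ := y
  obtain ⟨f, g, hg, rfl, -⟩ := (hs.mem_kronecker_iff 𝒜).1 hx
  obtain ⟨f', g', hg', rfl, -⟩ := (hs.mem_kronecker_iff 𝒜).1 hy
  have hg1 := toRatFunc_ne_zero K hg
  have hg1' := toRatFunc_ne_zero K hg'
  -- Here `p` and `q` are the numerators over the common denominator `g * g'`; `n` exceeds the
  -- degree of `p`, so that the coefficients of `p` and `q X^n` do not overlap.
  set p := f * g' with hp
  set q := f' * g with hq
  set n := p.natDegree + 1 with hn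
  set w := p + q * Polynomial.X ^ n with hw
  have hle : polyContent 𝒜 p ⊔ polyContent 𝒜 q ≤ polyContent 𝒜 w :=
    polyContent_le_add_mul_X_pow 𝒜 (Nat.lt_succ_self _)
  have hz : toRatFunc K f / toRatFunc K g + toRatFunc K f' / toRatFunc K g' * RatFunc.X ^ n =
      toRatFunc K w / (toRatFunc K g * toRatFunc K g') := by
    have hX : toRatFunc K (Polynomial.X ^ n : R[X]) = RatFunc.X ^ n := by simp [toRatFunc]
    rw [hw, hp, hq, toRatFunc_add, toRatFunc_mul, toRatFunc_mul, toRatFunc_mul, hX]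
    field_simp
  rcases eq_or_ne w 0 with h0 | h0
  · rw [h0, polyContent_zero, le_bot_iff, sup_eq_bot_iff] at hle
    have hp0 : p = 0 := by
      by_contra h
      exact polyContent_ne_bot 𝒜 h hle.1
    have hq0 : q = 0 := by
      by_contra h
      exact polyContent_ne_bot 𝒜 h hle.2
    have hf : f = 0 := (mul_eq_zero.1 hp0).resolve_right hg'
    have hf' : f' = 0 := (mul_eq_zero.1 hq0).resolve_right hg
    exact ⟨0, 0, 0, Subtype.ext (by simp [hf, toRatFunc_zero]),
      Subtype.ext (by simp [hf', toRatFunc_zero])⟩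
  · have hw1 := toRatFunc_ne_zero K h0
    refine ⟨n, ⟨_, div_mem_kroneckerSubring 𝒜 hs h0 ((IsLocalization.coeSubmodule_mono K
      (le_sup_left.trans hle)).trans (star.le_self _))⟩,
      ⟨_, div_mem_kroneckerSubring 𝒜 hs h0 ((IsLocalization.coeSubmodule_mono K
      (le_sup_right.trans hle)).trans (star.le_self _))⟩, Subtype.ext ?_, Subtype.ext ?_⟩
    · change _ = toRatFunc K p / toRatFunc K w * (toRatFunc K f / toRatFunc K g +
        toRatFunc K f' / toRatFunc K g' * RatFunc.X ^ n)
      rw [hz, hp, toRatFunc_mul]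
      field_simp
    · change _ = toRatFunc K q / toRatFunc K w * (toRatFunc K f / toRatFunc K g +
        toRatFunc K f' / toRatFunc K g' * RatFunc.X ^ n)
      rw [hz, hq, toRatFunc_mul]
      field_simp

theorem isBezout_kroneckerSubring : IsBezout (kroneckerSubring 𝒜 hs) := by
  rw [IsBezout.iff_span_pair_isPrincipal]
  intro x y
  obtain ⟨n, a, b, hx, hy⟩ := exists_eq_mul_kroneckerSubring 𝒜 hs x y
  refine ⟨⟨x + y * ⟨RatFunc.X, X_mem_kroneckerSubring 𝒜 hs⟩ ^ n,
    le_antisymm (Ideal.span_le.2 ?_) ((Submodule.span_singleton_le_iff_mem _ _).2 ?_)⟩⟩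
  · rintro z (rfl | rfl)
    · exact Ideal.mem_span_singleton'.2 ⟨a, hx.symm⟩
    · exact Ideal.mem_span_singleton'.2 ⟨b, hy.symm⟩
  · exact add_mem (Ideal.subset_span (by simp))
      (Ideal.mul_mem_right _ _ (Ideal.subset_span (by simp)))

/-! ### Extensions of homogeneous ideals -/

/-- For `r ∈ I` homogeneity gives `C(r) ⊆ I = 𝒜_h`, so `r / h` lies in the Kronecker ring. -/
theorem exists_eq_mul_of_mem_extendIdeal {I : Ideal R} {h : R[X]} (h0 : h ≠ 0)
    (hI : I.IsHomogeneous 𝒜) (hh : polyContent 𝒜 h = I) {φ : RatFunc K}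
    (hφ : φ ∈ extendIdeal (kroneckerSubring 𝒜 hs) I) :
    ∃ ψ ∈ kroneckerSubring 𝒜 hs, φ = ψ * toRatFunc K h := by
  have h1 := toRatFunc_ne_zero K h0
  induction hφ using Submodule.span_induction with
  | mem φ hφ =>
    obtain ⟨r, hr, rfl⟩ := hφ
    refine ⟨toRatFunc K (Polynomial.C r) / toRatFunc K h, div_mem_kroneckerSubring 𝒜 hs h0 ?_, ?_⟩
    · refine le_trans (IsLocalization.coeSubmodule_mono K ?_) (star.le_self _)
      rw [polyContent_C, hh]
      exact (homogeneousContent_le 𝒜).2 fun γ => hI γ hr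
    · rw [div_mul_cancel₀ _ h1, toRatFunc_C]
  | zero => exact ⟨0, zero_mem _, by simp⟩
  | add φ φ' _ _ ih ih' =>
    obtain ⟨ψ, hψ, rfl⟩ := ih
    obtain ⟨ψ', hψ', rfl⟩ := ih'
    exact ⟨ψ + ψ', add_mem hψ hψ', by ring⟩
  | smul s φ _ ih =>
    obtain ⟨ψ, hψ, rfl⟩ := ih
    exact ⟨s * ψ, mul_mem s.2 hψ, by rw [mul_assoc]; rfl⟩

/-- Writing `d = a/s = (f/g) h` gives `a g = s h f`. Taking contents and cancelling `𝒜_g` leaves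
`C(a) ⊆ (𝒜_(sh))^⋆ ⊆ (sI)^⋆`, which contains `a`; dividing by `s` ends the argument. -/
theorem mem_star_of_mem_extendIdeal {I : Ideal R} (hI0 : I ≠ ⊥) (hfg : I.FG)
    (hI : I.IsHomogeneous 𝒜) {d : K} (hd : d ∈ homogeneousQuotientField 𝒜 K)
    (hdI : RatFunc.C d ∈ extendIdeal (kroneckerSubring 𝒜 hs) I) : d ∈ star (coeSubmodule K I) := by
  obtain ⟨h, hh⟩ := exists_polyContent_eq 𝒜 hI hfg
  have h0 : h ≠ 0 := by
    rintro rfl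
    exact hI0 (hh ▸ polyContent_zero 𝒜)
  obtain ⟨a, s, hsH, rfl⟩ := (mem_homogeneousQuotientField 𝒜).1 hd
  have hs0 : s ≠ 0 := nonZeroDivisors.ne_zero hsH.2
  have hs1 : algebraMap R K s ≠ 0 := by simpa using hs0
  obtain ⟨ψ, hψ, hdψ⟩ := exists_eq_mul_of_mem_extendIdeal 𝒜 hs h0 hI hh hdI
  obtain ⟨f, g, hg, rfl, hfg⟩ := (hs.mem_kronecker_iff 𝒜).1 hψ
  have hsC : toRatFunc K (Polynomial.C s) ≠ 0 := toRatFunc_ne_zero K (by simpa using hs0)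
  have hg1 := toRatFunc_ne_zero K hg
  have heq : Polynomial.C a * g = Polynomial.C s * h * f := by
    apply toRatFunc_injective K
    rw [map_div₀, ← toRatFunc_C, ← toRatFunc_C] at hdψ
    simp only [toRatFunc_mul]
    field_simp at hdψ
    rw [hdψ]
    ring
  have h1 : fieldContent 𝒜 K (Polynomial.C a) * fieldContent 𝒜 K g ≤
      star (fieldContent 𝒜 K (Polynomial.C s * h) * fieldContent 𝒜 K g) := by
    refine star.le_star_of_le_star (hs.fieldContent_mul_le_star 𝒜 _ _) ?_
    rw [heq]
    exact (fieldContent_mul_le 𝒜 K _ _).trans (star.mul_le_star_mul (star.le_self _) hfg)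
  rw [mul_comm, mul_comm _ (fieldContent 𝒜 K g)] at h1
  have h2 := hs.le_star_of_mul_le (fg_fieldContent 𝒜 K g) (fieldContent_ne_bot 𝒜 K hg)
    (fg_fieldContent 𝒜 K _) (fg_fieldContent 𝒜 K _)
    (fieldContent_ne_bot 𝒜 K (mul_ne_zero (by simpa using hs0) h0)) h1
  -- Homogeneity of the denominator is needed here: it makes the content of the constant `s` no
  -- larger than `sR`.
  have h3 : polyContent 𝒜 (Polynomial.C s * h) ≤ Ideal.span {s} * I := by
    obtain ⟨σ, hσ⟩ := hsH.1
    refine (polyContent_mul_le 𝒜 _ _).trans ?_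
    rw [hh, polyContent_C]
    refine Ideal.mul_mono_left ((homogeneousContent_le 𝒜).2 fun γ => ?_)
    by_cases hγ : σ = γ
    · subst hγ
      rw [DirectSum.decompose_of_mem_same 𝒜 hσ]
      exact Ideal.mem_span_singleton_self s
    · rw [DirectSum.decompose_of_mem_ne 𝒜 hσ hγ]
      exact zero_mem _
  have h4 := (h2.trans (star.mono _ _ (IsLocalization.coeSubmodule_mono K h3)))
    (Submodule.mem_map_of_mem (f := Algebra.linearMap R K)
      (coeff_mem_polyContent 𝒜 (Polynomial.C a) 0))
  rw [Polynomial.coeff_C_zero, star_coeSubmodule_span_singleton_mul hs0,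
    Submodule.mem_smul_pointwise_iff_exists] at h4
  obtain ⟨x, hx, hxa⟩ := h4
  rw [Algebra.linearMap_apply, smul_eq_mul] at hxa
  rwa [← hxa, mul_div_cancel_left₀ _ hs1]

/-- If `I^⋆ ⊆ R_H` and, for all `a / s ∈ I^⋆`, all homogeneous components of `a` lie in `sI^⋆`,
then `I^⋆` is recovered from the Kronecker function ring. -/
theorem star_eq_extendIdeal_inter {I : Ideal R} (hI0 : I ≠ ⊥) (hfg : I.FG)
    (hI : I.IsHomogeneous 𝒜)
    (hle : ∀ d ∈ star (coeSubmodule K I), d ∈ homogeneousQuotientField 𝒜 K)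
    (hcomp : ∀ a s : R, s ∈ nonzeroHomogeneous 𝒜 →
      algebraMap R K a ∈ star (coeSubmodule K (Ideal.span {s} * I)) →
      coeSubmodule K (homogeneousContent 𝒜 a) ≤ star (coeSubmodule K (Ideal.span {s} * I))) :
    (star (coeSubmodule K I) : Set K) =
      {d | RatFunc.C d ∈ extendIdeal (kroneckerSubring 𝒜 hs) I} ∩
        (homogeneousQuotientField 𝒜 K : Set K) := by
  refine Set.Subset.antisymm (fun d hd => ⟨?_, hle d hd⟩)
    fun d hd => mem_star_of_mem_extendIdeal 𝒜 hs hI0 hfg hI hd.2 hd.1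
  obtain ⟨h, hh⟩ := exists_polyContent_eq 𝒜 hI hfg
  have h0 : h ≠ 0 := by
    rintro rfl
    exact hI0 (hh ▸ polyContent_zero 𝒜)
  obtain ⟨a, s, hsH, rfl⟩ := (mem_homogeneousQuotientField 𝒜).1 (hle d hd)
  have hs0 : s ≠ 0 := nonZeroDivisors.ne_zero hsH.2
  have hs1 : algebraMap R K s ≠ 0 := by simpa using hs0
  have ha : algebraMap R K a ∈ star (coeSubmodule K (Ideal.span {s} * I)) := by
    rw [star_coeSubmodule_span_singleton_mul hs0]
    have := Submodule.smul_mem_pointwise_smul _ (algebraMap R K s) _ hd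
    rwa [smul_eq_mul, mul_div_cancel₀ _ hs1] at this
  obtain ⟨σ, hσ⟩ := hsH.1
  -- The converse writes `d = (a / (s h)) h`; the first factor lies in the Kronecker ring because
  -- `C(a) ⊆ (sI)^⋆` and `sI ⊆ 𝒜_(sh)`.
  have hS : toRatFunc K (Polynomial.C a) / toRatFunc K (Polynomial.C s * h) ∈
      kroneckerSubring 𝒜 hs := by
    refine div_mem_kroneckerSubring 𝒜 hs (mul_ne_zero (by simpa using hs0) h0) ?_
    rw [fieldContent, polyContent_C]
    refine (hcomp a s hsH ha).trans (star.mono _ _ (IsLocalization.coeSubmodule_mono K ?_))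
    rw [← hh]
    exact span_singleton_mul_polyContent_le 𝒜 hσ h
  have hmem : toRatFunc K h ∈ extendIdeal (kroneckerSubring 𝒜 hs) I :=
    toRatFunc_mem_extendIdeal (X_mem_kroneckerSubring 𝒜 hs)
      fun i => hh ▸ coeff_mem_polyContent 𝒜 h i
  have hsC : toRatFunc K (Polynomial.C s) ≠ 0 := toRatFunc_ne_zero K (by simpa using hs0)
  have h1 := toRatFunc_ne_zero K h0
  have heq : RatFunc.C (algebraMap R K a / algebraMap R K s) =
      toRatFunc K (Polynomial.C a) / toRatFunc K (Polynomial.C s * h) * toRatFunc K h := by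
    rw [map_div₀, ← toRatFunc_C, ← toRatFunc_C, toRatFunc_mul]
    field_simp
  rw [Set.mem_ofPred_eq, heq]
  exact Submodule.smul_mem _ (⟨_, hS⟩ : kroneckerSubring 𝒜 hs) hmem

end Kronecker

open Algebra (GrothendieckAddGroup)

section QuotientGrading

variable {R : Type*} [CommRing R] [IsDomain R] {Γ : Type*} [AddCancelCommMonoid Γ] [DecidableEq Γ]
  (𝒜 : Γ → AddSubgroup R) [GradedRing 𝒜] (K : Type*) [Field K] [Algebra R K] [IsFractionRing R K]

open DirectSum

/-! ### The grading of the homogeneous quotient field -/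

variable {K}

theorem mul_mem_homogeneousComponent {α β : GrothendieckAddGroup Γ} {x y : K}
    (hx : x ∈ homogeneousComponent 𝒜 K α) (hy : y ∈ homogeneousComponent 𝒜 K β) :
    x * y ∈ homogeneousComponent 𝒜 K (α + β) := by
  rcases hx with rfl | ⟨γ, σ, a, s, ha, hs, hs0, rfl, rfl⟩
  · rw [zero_mul]
    exact zero_mem _
  rcases hy with rfl | ⟨δ, τ, b, t, hb, ht, ht0, rfl, rfl⟩
  · rw [mul_zero]
    exact zero_mem _
  refine Or.inr ⟨γ + δ, σ + τ, a * b, s * t, SetLike.mul_mem_graded ha hb,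
    SetLike.mul_mem_graded hs ht, mul_ne_zero hs0 ht0, ?_, ?_⟩
  · rw [map_add, map_add]
    abel
  · rw [map_mul, map_mul, div_mul_div_comm]

theorem inv_mem_homogeneousComponent {α : GrothendieckAddGroup Γ} {x : K}
    (hx : x ∈ homogeneousComponent 𝒜 K α) : x⁻¹ ∈ homogeneousComponent 𝒜 K (-α) := by
  rcases hx with rfl | ⟨γ, σ, a, s, ha, hs, hs0, rfl, rfl⟩
  · rw [inv_zero]
    exact zero_mem _
  · rcases eq_or_ne a 0 with rfl | ha0
    · simp [zero_mem]
    · exact Or.inr ⟨σ, γ, s, a, hs, ha, ha0, (neg_sub _ _).symm, inv_div _ _⟩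

theorem algebraMap_mem_homogeneousComponent {a : R} {γ : Γ} (ha : a ∈ 𝒜 γ) :
    algebraMap R K a ∈ homogeneousComponent 𝒜 K (GrothendieckAddGroup.of γ) :=
  Or.inr ⟨γ, 0, a, 1, ha, SetLike.one_mem_graded 𝒜, one_ne_zero, by simp, by simp⟩

theorem one_mem_homogeneousComponent : (1 : K) ∈ homogeneousComponent 𝒜 K 0 := by
  have := algebraMap_mem_homogeneousComponent 𝒜 (K := K) (SetLike.one_mem_graded 𝒜)
  rwa [map_one, map_zero] at this

theorem pow_mem_homogeneousComponent {α : GrothendieckAddGroup Γ} {x : K}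
    (hx : x ∈ homogeneousComponent 𝒜 K α) (n : ℕ) : x ^ n ∈ homogeneousComponent 𝒜 K (n • α) := by
  induction n with
  | zero => simpa using one_mem_homogeneousComponent 𝒜
  | succ n ih =>
    rw [pow_succ, succ_nsmul]
    exact mul_mem_homogeneousComponent 𝒜 ih hx

theorem zpow_mem_homogeneousComponent {α : GrothendieckAddGroup Γ} {x : K}
    (hx : x ∈ homogeneousComponent 𝒜 K α) (n : ℤ) : x ^ n ∈ homogeneousComponent 𝒜 K (n • α) := by
  obtain ⟨n, rfl | rfl⟩ := n.eq_nat_or_neg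
  · simpa using pow_mem_homogeneousComponent 𝒜 hx n
  · simpa using inv_mem_homogeneousComponent 𝒜 (pow_mem_homogeneousComponent 𝒜 hx n)

theorem prod_mem_homogeneousComponent {ι : Type*} (s : Finset ι) {α : ι → GrothendieckAddGroup Γ}
    {x : ι → K} (hx : ∀ i ∈ s, x i ∈ homogeneousComponent 𝒜 K (α i)) :
    ∏ i ∈ s, x i ∈ homogeneousComponent 𝒜 K (∑ i ∈ s, α i) := by
  classical
  induction s using Finset.induction_on with
  | empty => simpa using one_mem_homogeneousComponent 𝒜
  | insert i s hi ih =>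
    rw [Finset.prod_insert hi, Finset.sum_insert hi]
    exact mul_mem_homogeneousComponent 𝒜 (hx i (Finset.mem_insert_self i s))
      (ih fun j hj => hx j (Finset.mem_insert_of_mem hj))

/-! ### Parts of `R_H` supported in a set of degrees -/

variable (K)

/-- The sum of the components of `R_H` with degrees in `A`. -/
def gradedPart (A : Set (GrothendieckAddGroup Γ)) : AddSubgroup K :=
  AddSubgroup.closure {x | ∃ α ∈ A, x ∈ homogeneousComponent 𝒜 K α}

variable {K}

theorem mem_gradedPart_of_mem {A : Set (GrothendieckAddGroup Γ)} {α : GrothendieckAddGroup Γ}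
    (hα : α ∈ A) {x : K} (hx : x ∈ homogeneousComponent 𝒜 K α) : x ∈ gradedPart 𝒜 K A :=
  AddSubgroup.subset_closure ⟨α, hα, hx⟩

theorem div_mem_gradedPart {A : Set (GrothendieckAddGroup Γ)} {b t : R} {τ : Γ} (ht : t ∈ 𝒜 τ)
    (h : ∀ γ, (decompose 𝒜 b γ : R) ≠ 0 →
      GrothendieckAddGroup.of γ - GrothendieckAddGroup.of τ ∈ A) :
    algebraMap R K b / algebraMap R K t ∈ gradedPart 𝒜 K A := by
  classical
  rw [← sum_support_decompose 𝒜 b, map_sum, Finset.sum_div]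
  refine sum_mem fun γ hγ => mem_gradedPart_of_mem 𝒜 (h γ (by simpa using hγ)) ?_
  rw [div_eq_mul_inv, sub_eq_add_neg]
  exact mul_mem_homogeneousComponent 𝒜 (algebraMap_mem_homogeneousComponent 𝒜 (SetLike.coe_mem _))
    (inv_mem_homogeneousComponent 𝒜 (algebraMap_mem_homogeneousComponent 𝒜 ht))

/-- A sum of homogeneous elements of `E` is a fraction `b / t` with homogeneous denominator such
that all components `b_γ / t` lie in `E`. -/
theorem exists_eq_div_of_mem_iSup {E : AddSubgroup K} {x : K}
    (hx : x ∈ ⨆ α : GrothendieckAddGroup Γ, E ⊓ homogeneousComponent 𝒜 K α) :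
    ∃ (b t : R) (τ : Γ), t ∈ 𝒜 τ ∧ t ≠ 0 ∧ x = algebraMap R K b / algebraMap R K t ∧
      ∀ γ, algebraMap R K (decompose 𝒜 b γ) / algebraMap R K t ∈ E := by
  induction hx using AddSubgroup.iSup_induction' with
  | hp α x hx =>
    obtain ⟨hE, rfl | ⟨β, τ, a, t, ha, ht, ht0, -, rfl⟩⟩ := hx
    · exact ⟨0, 1, 0, SetLike.one_mem_graded 𝒜, one_ne_zero, by simp, fun γ => by simp [zero_mem]⟩
    · refine ⟨a, t, τ, ht, ht0, rfl, fun γ => ?_⟩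
      by_cases hγ : β = γ
      · subst hγ
        rwa [decompose_of_mem_same 𝒜 ha]
      · rw [decompose_of_mem_ne 𝒜 ha hγ]
        simp [zero_mem]
  | h1 => exact ⟨0, 1, 0, SetLike.one_mem_graded 𝒜, one_ne_zero, by simp, fun γ => by simp [zero_mem]⟩
  | hadd x y _ _ ihx ihy =>
    obtain ⟨b, t, τ, ht, ht0, rfl, hb⟩ := ihx
    obtain ⟨b', t', τ', ht', ht0', rfl, hb'⟩ := ihy
    have ht1 : algebraMap R K t ≠ 0 := by simpa using ht0
    have ht1' : algebraMap R K t' ≠ 0 := by simpa using ht0'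
    refine ⟨b * t' + b' * t, t * t', τ + τ', SetLike.mul_mem_graded ht ht', mul_ne_zero ht0 ht0',
      by simp only [map_add, map_mul]; field_simp, fun δ => ?_⟩
    -- Passing to the common denominator shifts the components of `b` by `τ'` and multiplies them by
    -- `t'`, leaving the quotients unchanged; degrees outside `Γ + τ'` contribute zero.
    have key : ∀ {b t t' : R} {τ' : Γ}, t ≠ 0 → t' ≠ 0 → t' ∈ 𝒜 τ' →
        (∀ γ, algebraMap R K (decompose 𝒜 b γ) / algebraMap R K t ∈ E) →
        algebraMap R K (decompose 𝒜 (b * t') δ) / algebraMap R K (t * t') ∈ E := by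
      intro b t t' τ' ht0 ht0' ht' hb
      have ht1' : algebraMap R K t' ≠ 0 := by simpa using ht0'
      by_cases hδ : ∃ γ, δ = γ + τ'
      · obtain ⟨γ, rfl⟩ := hδ
        rw [coe_decompose_mul_add_of_right_mem 𝒜 ht', map_mul, map_mul,
          mul_div_mul_right _ _ ht1']
        exact hb γ
      · rw [coe_decompose_mul_eq_zero 𝒜 ht' (by simpa using hδ)]
        simp [zero_mem]
    rw [decompose_add, DirectSum.add_apply, AddMemClass.coe_add, map_add, add_div]
    refine add_mem (key ht0 ht0' ht' hb) ?_
    rw [mul_comm t t']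
    exact key ht0' ht0 ht hb'

theorem exists_eq_div_of_mem_gradedPart {A : Set (GrothendieckAddGroup Γ)} {x : K}
    (hx : x ∈ gradedPart 𝒜 K A) :
    ∃ (b t : R) (τ : Γ), t ∈ 𝒜 τ ∧ t ≠ 0 ∧ x = algebraMap R K b / algebraMap R K t ∧
      ∀ γ, (decompose 𝒜 b γ : R) ≠ 0 →
        GrothendieckAddGroup.of γ - GrothendieckAddGroup.of τ ∈ A := by
  induction hx using AddSubgroup.closure_induction with
  | mem x hx =>
    obtain ⟨α, hα, rfl | ⟨β, τ, a, t, ha, ht, ht0, rfl, rfl⟩⟩ := hx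
    · exact ⟨0, 1, 0, SetLike.one_mem_graded 𝒜, one_ne_zero, by simp, fun γ h => by simp at h⟩
    · refine ⟨a, t, τ, ht, ht0, rfl, fun γ hγ => ?_⟩
      by_cases h : β = γ
      · rwa [← h]
      · exact absurd (decompose_of_mem_ne 𝒜 ha h) hγ
  | zero => exact ⟨0, 1, 0, SetLike.one_mem_graded 𝒜, one_ne_zero, by simp, fun γ h => by simp at h⟩
  | neg x _ ih =>
    obtain ⟨b, t, τ, ht, ht0, rfl, hb⟩ := ih
    exact ⟨-b, t, τ, ht, ht0, by rw [map_neg, neg_div], fun γ hγ => hb γ (by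
      rwa [decompose_neg, DFinsupp.neg_apply, NegMemClass.coe_neg, neg_ne_zero] at hγ)⟩
  | add x y _ _ ihx ihy =>
    obtain ⟨b, t, τ, ht, ht0, rfl, hb⟩ := ihx
    obtain ⟨b', t', τ', ht', ht0', rfl, hb'⟩ := ihy
    have ht1 : algebraMap R K t ≠ 0 := by simpa using ht0
    have ht1' : algebraMap R K t' ≠ 0 := by simpa using ht0'
    refine ⟨b * t' + b' * t, t * t', τ + τ', SetLike.mul_mem_graded ht ht', mul_ne_zero ht0 ht0',
      by simp only [map_add, map_mul]; field_simp, fun δ hδ => ?_⟩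
    have key : ∀ {b t' : R} {τ τ' : Γ}, t' ∈ 𝒜 τ' → (∀ γ, (decompose 𝒜 b γ : R) ≠ 0 →
        GrothendieckAddGroup.of γ - GrothendieckAddGroup.of τ ∈ A) →
        (decompose 𝒜 (b * t') δ : R) ≠ 0 →
        GrothendieckAddGroup.of δ - GrothendieckAddGroup.of (τ + τ') ∈ A := by
      intro b t' τ τ' ht' hb hδ
      by_cases h : ∃ γ, δ = γ + τ'
      · obtain ⟨γ, rfl⟩ := h
        rw [coe_decompose_mul_add_of_right_mem 𝒜 ht'] at hδ
        rw [map_add, map_add, add_sub_add_right_eq_sub]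
        exact hb γ (left_ne_zero_of_mul hδ)
      · exact absurd (coe_decompose_mul_eq_zero 𝒜 ht' (by simpa using h)) hδ
    rw [decompose_add, DirectSum.add_apply, AddMemClass.coe_add] at hδ
    by_cases h : (decompose 𝒜 (b * t') δ : R) = 0
    · rw [h, zero_add] at hδ
      rw [add_comm τ]
      exact key ht hb' hδ
    · exact key ht' hb h

theorem mem_homogeneousQuotientField_iff_gradedPart {x : K} :
    x ∈ homogeneousQuotientField 𝒜 K ↔ x ∈ gradedPart 𝒜 K Set.univ := by
  rw [mem_homogeneousQuotientField]
  constructor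
  · rintro ⟨a, s, ⟨⟨σ, hσ⟩, -⟩, rfl⟩
    exact div_mem_gradedPart 𝒜 hσ fun _ _ => Set.mem_univ _
  · intro hx
    obtain ⟨b, t, τ, ht, ht0, rfl, -⟩ := exists_eq_div_of_mem_gradedPart 𝒜 hx
    exact ⟨b, t, ⟨⟨τ, ht⟩, mem_nonZeroDivisors_of_ne_zero ht0⟩, rfl⟩

/-- This is the directness of the sum of the `(R_H)_α`. After clearing homogeneous denominators, a
nonzero component of the common numerator would determine a degree lying in both `A` and `B`. -/
theorem eq_zero_of_mem_gradedPart {A B : Set (GrothendieckAddGroup Γ)} (hAB : Disjoint A B) {x : K}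
    (hA : x ∈ gradedPart 𝒜 K A) (hB : x ∈ gradedPart 𝒜 K B) : x = 0 := by
  obtain ⟨b, t, τ, ht, ht0, rfl, hb⟩ := exists_eq_div_of_mem_gradedPart 𝒜 hA
  obtain ⟨b', t', τ', ht', ht0', heq, hb'⟩ := exists_eq_div_of_mem_gradedPart 𝒜 hB
  have ht1 : algebraMap R K t ≠ 0 := by simpa using ht0
  have ht1' : algebraMap R K t' ≠ 0 := by simpa using ht0'
  rw [div_eq_div_iff ht1 ht1', ← map_mul, ← map_mul] at heq
  have heq' : b * t' = b' * t := IsFractionRing.injective R K heq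
  have h0 : b * t' = 0 := by
    classical
    rw [← sum_support_decompose 𝒜 (b * t')]
    refine Finset.sum_eq_zero fun δ _ => ?_
    by_contra h
    have hγ : ∃ γ, δ = γ + τ' := by
      by_contra h1
      exact h (coe_decompose_mul_eq_zero 𝒜 ht' (by simpa using h1))
    have hγ' : ∃ γ, δ = γ + τ := by
      by_contra h1
      rw [heq'] at h
      exact h (coe_decompose_mul_eq_zero 𝒜 ht (by simpa using h1))
    obtain ⟨γ, rfl⟩ := hγ
    obtain ⟨γ', hγ'⟩ := hγ'
    have h1 := h
    rw [coe_decompose_mul_add_of_right_mem 𝒜 ht'] at h1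
    rw [heq', hγ', coe_decompose_mul_add_of_right_mem 𝒜 ht] at h
    have h2 := hb γ (left_ne_zero_of_mul h1)
    have h3 := hb' γ' (left_ne_zero_of_mul h)
    have h4 : GrothendieckAddGroup.of γ - GrothendieckAddGroup.of τ =
        GrothendieckAddGroup.of γ' - GrothendieckAddGroup.of τ' := by
      rw [sub_eq_sub_iff_add_eq_add, ← map_add, ← map_add, hγ']
    exact Set.disjoint_left.1 hAB h2 (h4 ▸ h3)
  rw [(mul_eq_zero.1 h0).resolve_right ht0', map_zero, zero_div]

theorem mul_mem_gradedPart {A B C : Set (GrothendieckAddGroup Γ)}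
    (h : ∀ α ∈ A, ∀ β ∈ B, α + β ∈ C) {x y : K} (hx : x ∈ gradedPart 𝒜 K A)
    (hy : y ∈ gradedPart 𝒜 K B) : x * y ∈ gradedPart 𝒜 K C := by
  induction hx using AddSubgroup.closure_induction with
  | mem x hx =>
    obtain ⟨α, hα, hx⟩ := hx
    induction hy using AddSubgroup.closure_induction with
    | mem y hy =>
      obtain ⟨β, hβ, hy⟩ := hy
      exact mem_gradedPart_of_mem 𝒜 (h α hα β hβ) (mul_mem_homogeneousComponent 𝒜 hx hy)
    | zero => simp [zero_mem]
    | neg y _ ih => rw [mul_neg]; exact neg_mem ih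
    | add y y' _ _ ih ih' => rw [mul_add]; exact add_mem ih ih'
  | zero => simp [zero_mem]
  | neg x _ ih => rw [neg_mul]; exact neg_mem ih
  | add x x' _ _ ih ih' => rw [add_mul]; exact add_mem ih ih'

theorem pow_mem_gradedPart {G : Submodule ℤ (GrothendieckAddGroup Γ)} {x : K}
    (hx : x ∈ gradedPart 𝒜 K G) (n : ℕ) : x ^ n ∈ gradedPart 𝒜 K G := by
  induction n with
  | zero =>
    rw [pow_zero]
    exact mem_gradedPart_of_mem 𝒜 (zero_mem G) (one_mem_homogeneousComponent 𝒜)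
  | succ n ih =>
    rw [pow_succ]
    exact mul_mem_gradedPart 𝒜 (fun _ h _ h' => Submodule.add_mem _ h h') ih hx

theorem exists_add_of_mem_homogeneousQuotientField (A : Set (GrothendieckAddGroup Γ)) {x : K}
    (hx : x ∈ homogeneousQuotientField 𝒜 K) :
    ∃ y ∈ gradedPart 𝒜 K A, ∃ z ∈ gradedPart 𝒜 K Aᶜ, x = y + z := by
  rw [mem_homogeneousQuotientField_iff_gradedPart] at hx
  induction hx using AddSubgroup.closure_induction with
  | mem x hx =>
    obtain ⟨α, -, hx⟩ := hx
    by_cases hα : α ∈ A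
    · exact ⟨x, mem_gradedPart_of_mem 𝒜 hα hx, 0, zero_mem _, by simp⟩
    · exact ⟨0, zero_mem _, x, mem_gradedPart_of_mem 𝒜 (show α ∈ Aᶜ from hα) hx, by simp⟩
  | zero => exact ⟨0, zero_mem _, 0, zero_mem _, by simp⟩
  | neg x _ ih =>
    obtain ⟨y, hy, z, hz, rfl⟩ := ih
    exact ⟨-y, neg_mem hy, -z, neg_mem hz, by abel⟩
  | add x x' _ _ ih ih' =>
    obtain ⟨y, hy, z, hz, rfl⟩ := ih
    obtain ⟨y', hy', z', hz', rfl⟩ := ih'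
    exact ⟨y + y', add_mem hy hy', z + z', add_mem hz hz', by abel⟩

/-- Multiplication by `q` respects the splitting of `R_H` into degrees in the group `G` and degrees
outside it, so the outside part `z` of `x` satisfies `q z = 0`. -/
theorem mem_gradedPart_of_mul_mem {G : Submodule ℤ (GrothendieckAddGroup Γ)} {q x : K} (hq0 : q ≠ 0)
    (hq : q ∈ gradedPart 𝒜 K G) (hx : x ∈ homogeneousQuotientField 𝒜 K)
    (hqx : q * x ∈ gradedPart 𝒜 K G) : x ∈ gradedPart 𝒜 K G := by
  obtain ⟨y, hy, z, hz, rfl⟩ := exists_add_of_mem_homogeneousQuotientField 𝒜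
    (G : Set (GrothendieckAddGroup Γ)) hx
  have hqy := mul_mem_gradedPart 𝒜 (fun _ h _ h' => G.add_mem h h') hq hy
  have hqz : q * z ∈ gradedPart 𝒜 K (G : Set (GrothendieckAddGroup Γ))ᶜ :=
    mul_mem_gradedPart 𝒜 (B := (G : Set (GrothendieckAddGroup Γ))ᶜ)
      (C := (G : Set (GrothendieckAddGroup Γ))ᶜ)
      (fun α h β h' h'' => h' ((G.add_mem_iff_right h).1 h'')) hq hz
  have hqz' : q * z ∈ gradedPart 𝒜 K (G : Set (GrothendieckAddGroup Γ)) := by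
    rw [mul_add] at hqx
    simpa using sub_mem hqx hqy
  have := eq_zero_of_mem_gradedPart 𝒜 disjoint_compl_right hqz' hqz
  rw [(mul_eq_zero.1 this).resolve_left hq0, add_zero]
  exact hy

theorem mem_homogeneousQuotientField_of_mem_homogeneousComponent {α : GrothendieckAddGroup Γ}
    {x : K} (hx : x ∈ homogeneousComponent 𝒜 K α) : x ∈ homogeneousQuotientField 𝒜 K :=
  (mem_homogeneousQuotientField_iff_gradedPart 𝒜).2 (mem_gradedPart_of_mem 𝒜 (Set.mem_univ α) hx)

/-! ### Homogeneous submodules -/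

variable {𝒜}

theorem IsHomogeneousSubmodule.mem_homogeneousQuotientField {E : Submodule R K}
    (hE : IsHomogeneousSubmodule 𝒜 K E) {x : K} (hx : x ∈ E) :
    x ∈ homogeneousQuotientField 𝒜 K := by
  have hx' : x ∈ E.toAddSubgroup := hx
  rw [hE] at hx'
  obtain ⟨b, t, τ, ht, ht0, rfl, -⟩ := exists_eq_div_of_mem_iSup 𝒜 hx'
  exact (GradedKronecker.mem_homogeneousQuotientField 𝒜).2
    ⟨b, t, ⟨⟨τ, ht⟩, mem_nonZeroDivisors_of_ne_zero ht0⟩, rfl⟩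

theorem IsHomogeneousSubmodule.algebraMap_decompose_mem {E : Submodule R K}
    (hE : IsHomogeneousSubmodule 𝒜 K E) {a : R} (ha : algebraMap R K a ∈ E) (γ : Γ) :
    algebraMap R K (decompose 𝒜 a γ) ∈ E := by
  have ha' : algebraMap R K a ∈ E.toAddSubgroup := ha
  rw [hE] at ha'
  obtain ⟨b, t, τ, ht, ht0, heq, hb⟩ := exists_eq_div_of_mem_iSup 𝒜 ha'
  have ht1 : algebraMap R K t ≠ 0 := by simpa using ht0
  rw [eq_div_iff ht1, ← map_mul] at heq
  have heq' : a * t = b := IsFractionRing.injective R K heq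
  -- With `b = a t`, the component `b_(γ+τ)` is `a_γ t`.
  have := hb (γ + τ)
  rwa [← heq', coe_decompose_mul_add_of_right_mem 𝒜 ht, map_mul, mul_div_cancel_right₀ _ ht1]
    at this

variable (𝒜)

/-! ### Complete integral closedness of the homogeneous quotient field -/

variable (K)

/-- The elements of `R_H` of degree zero form a field. -/
def degreeZeroSubfield : Subfield K where
  carrier := homogeneousComponent 𝒜 K 0
  mul_mem' h h' := by simpa using mul_mem_homogeneousComponent 𝒜 h h'
  one_mem' := one_mem_homogeneousComponent 𝒜
  add_mem' h h' := add_mem h h'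
  zero_mem' := zero_mem (homogeneousComponent 𝒜 K 0)
  neg_mem' h := neg_mem (S := AddSubgroup K) h
  inv_mem' x h := by simpa using inv_mem_homogeneousComponent 𝒜 h

variable {K}

/-! ### Laurent polynomials in homogeneous elements of independent degrees -/

section Monomials

variable {ι : Type*} [Fintype ι] {u : ι → K} {d : ι → GrothendieckAddGroup Γ}

omit [Fintype ι] in
theorem aeval_mem_homogeneousQuotientField (hu : ∀ i, u i ∈ homogeneousComponent 𝒜 K (d i))
    (p : MvPolynomial ι (degreeZeroSubfield 𝒜 K)) :
    MvPolynomial.aeval u p ∈ homogeneousQuotientField 𝒜 K := by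
  induction p using MvPolynomial.induction_on with
  | C a =>
    rw [MvPolynomial.aeval_C]
    exact mem_homogeneousQuotientField_of_mem_homogeneousComponent 𝒜 a.2
  | add p q hp hq =>
    rw [map_add]
    exact add_mem hp hq
  | mul_X p i hp =>
    rw [map_mul, MvPolynomial.aeval_X]
    exact mul_mem hp (mem_homogeneousQuotientField_of_mem_homogeneousComponent 𝒜 (hu i))

/-- Independence of the degrees `d i` puts distinct monomials in distinct degrees, so no
cancellation can occur. -/
theorem aeval_injective (hu : ∀ i, u i ∈ homogeneousComponent 𝒜 K (d i)) (hu0 : ∀ i, u i ≠ 0)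
    (hd : LinearIndependent ℤ d) :
    Function.Injective
      (MvPolynomial.aeval u : MvPolynomial ι (degreeZeroSubfield 𝒜 K) →ₐ[_] K) := by
  classical
  rw [injective_iff_map_eq_zero]
  intro p hp
  by_contra hp0
  obtain ⟨m, hm⟩ := MvPolynomial.support_nonempty.2 hp0
  rw [MvPolynomial.aeval_def, MvPolynomial.eval₂_eq'] at hp
  set T : (ι →₀ ℕ) → K := fun m => algebraMap (degreeZeroSubfield 𝒜 K) K (p.coeff m) *
    ∏ i, u i ^ m i with hT
  have hdeg : ∀ m, T m ∈ homogeneousComponent 𝒜 K (∑ i, m i • d i) := by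
    intro m
    have := mul_mem_homogeneousComponent 𝒜 (p.coeff m).2 (prod_mem_homogeneousComponent 𝒜
      Finset.univ fun i _ => pow_mem_homogeneousComponent 𝒜 (hu i) (m i))
    rwa [zero_add] at this
  have hinj : ∀ m' : ι →₀ ℕ, m' ≠ m → ∑ i, m' i • d i ≠ ∑ i, m i • d i := by
    intro m' hne heq
    apply hne
    ext i
    have h1 : ∑ i, ((m' i : ℤ) - m i) • d i = 0 := by
      simp only [sub_smul, Finset.sum_sub_distrib, natCast_zsmul, heq, sub_self]
    have := Fintype.linearIndependent_iff.1 hd _ h1 i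
    omega
  have hTm : T m = -∑ m' ∈ p.support.erase m, T m' := by
    rw [eq_neg_iff_add_eq_zero, Finset.add_sum_erase _ _ hm]
    exact hp
  have h0 : T m = 0 := by
    refine eq_zero_of_mem_gradedPart 𝒜 (disjoint_compl_right (a := {∑ i, m i • d i}))
      (mem_gradedPart_of_mem 𝒜 (Set.mem_singleton _) (hdeg m)) ?_
    rw [hTm]
    refine neg_mem (sum_mem fun m' hm' => mem_gradedPart_of_mem 𝒜 ?_ (hdeg m'))
    exact hinj m' (Finset.ne_of_mem_erase hm')
  rw [hT] at h0
  rcases mul_eq_zero.1 h0 with h | h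
  · rw [map_eq_zero] at h
    exact MvPolynomial.mem_support_iff.1 hm h
  · exact Finset.prod_ne_zero_iff.2 (fun i _ => pow_ne_zero _ (hu0 i)) h

/-- The part of `R_H` with degrees in the span of `d` consists of Laurent polynomials in the `u i`:
an element divided by the monomial of its degree has degree zero, hence is a scalar. -/
theorem exists_aeval_eq_of_mem_gradedPart (hu : ∀ i, u i ∈ homogeneousComponent 𝒜 K (d i))
    (hu0 : ∀ i, u i ≠ 0) {x : K} (hx : x ∈ gradedPart 𝒜 K (Submodule.span ℤ (Set.range d))) :
    ∃ (N : ℕ) (p : MvPolynomial ι (degreeZeroSubfield 𝒜 K)),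
      (∏ i, u i) ^ N * x = MvPolynomial.aeval u p := by
  induction hx using AddSubgroup.closure_induction with
  | mem x hx =>
    obtain ⟨α, hα, hx⟩ := hx
    obtain ⟨m, rfl⟩ := (Submodule.mem_span_range_iff_exists_fun ℤ).1 hα
    have hc : x * (∏ i, u i ^ m i)⁻¹ ∈ homogeneousComponent 𝒜 K 0 := by
      have := mul_mem_homogeneousComponent 𝒜 hx (inv_mem_homogeneousComponent 𝒜
        (prod_mem_homogeneousComponent 𝒜 Finset.univ
          fun i _ => zpow_mem_homogeneousComponent 𝒜 (hu i) (m i)))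
      rwa [add_neg_cancel] at this
    -- The sum of the `|m i|` is large enough to make every exponent nonnegative.
    refine ⟨∑ i, (m i).natAbs, MvPolynomial.C ⟨_, hc⟩ *
      ∏ i, MvPolynomial.X i ^ (m i + ∑ i, (m i).natAbs : ℤ).toNat, ?_⟩
    have hm : ∀ i, ((m i + ∑ i, (m i).natAbs : ℤ).toNat : ℤ) = m i + ∑ i, (m i).natAbs := by
      intro i
      have : (m i).natAbs ≤ ∑ i, (m i).natAbs :=
        Finset.single_le_sum (f := fun i => (m i).natAbs) (fun _ _ => Nat.zero_le _)
          (Finset.mem_univ i)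
      omega
    have hprod : ∏ i, u i ^ (m i + ∑ i, (m i).natAbs : ℤ).toNat =
        (∏ i, u i ^ m i) * (∏ i, u i) ^ (∑ i, (m i).natAbs) := by
      rw [← Finset.prod_pow, ← Finset.prod_mul_distrib]
      refine Finset.prod_congr rfl fun i _ => ?_
      rw [← zpow_natCast, hm, zpow_add₀ (hu0 i), zpow_natCast]
    have hne : ∏ i, u i ^ m i ≠ 0 := Finset.prod_ne_zero_iff.2 fun i _ => zpow_ne_zero _ (hu0 i)
    rw [map_mul, MvPolynomial.aeval_C, map_prod]
    simp only [map_pow, MvPolynomial.aeval_X]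
    rw [hprod]
    change _ = x * (∏ i, u i ^ m i)⁻¹ * _
    field_simp
  | zero => exact ⟨0, 0, by simp⟩
  | neg x _ ih =>
    obtain ⟨N, p, hp⟩ := ih
    exact ⟨N, -p, by rw [map_neg, ← hp, mul_neg]⟩
  | add x y _ _ ihx ihy =>
    obtain ⟨N, p, hp⟩ := ihx
    obtain ⟨N', q, hq⟩ := ihy
    refine ⟨N + N', (∏ i, MvPolynomial.X i) ^ N' * p + (∏ i, MvPolynomial.X i) ^ N * q, ?_⟩
    simp only [map_add, map_mul, map_pow, map_prod, MvPolynomial.aeval_X, ← hp, ← hq]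
    ring

end Monomials

/-! ### Denominators in a unique factorization domain -/

theorem exists_dvd_pow_of_forall_prime_dvd {P : Type*} [CommRing P] [IsDomain P]
    [UniqueFactorizationMonoid P] {b w : P} (hb : b ≠ 0) (h : ∀ q, Prime q → q ∣ b → q ∣ w) :
    ∃ N : ℕ, b ∣ w ^ N := by
  induction b using UniqueFactorizationMonoid.induction_on_prime with
  | h₁ => exact absurd rfl hb
  | h₂ x hx => exact ⟨0, hx.dvd⟩
  | h₃ a q ha hq ih =>
    obtain ⟨N, hN⟩ := ih ha fun q' hq' hdvd => h q' hq' (hdvd.mul_left q)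
    exact ⟨N + 1, by rw [pow_succ']; exact mul_dvd_mul (h q hq (dvd_mul_right q a)) hN⟩

/-- Since `a` is coprime to `b`, each `b ^ n` divides some `c * w ^ N`. A prime factor of `b` not
dividing `w` would then divide `c` to every order. -/
theorem exists_dvd_pow_of_forall_pow_dvd {P : Type*} [CommRing P] [IsDomain P]
    [UniqueFactorizationMonoid P] {a b c w : P} (hb : b ≠ 0) (hc : c ≠ 0) (hab : IsRelPrime a b)
    (h : ∀ n : ℕ, ∃ N : ℕ, b ^ n ∣ c * w ^ N * a ^ n) : ∃ N : ℕ, b ∣ w ^ N := by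
  refine exists_dvd_pow_of_forall_prime_dvd hb fun q hq hqb => ?_
  by_contra hqw
  obtain ⟨m, hm⟩ := FiniteMultiplicity.of_prime_left hq hc
  obtain ⟨N, hN⟩ := h (m + 1)
  have h1 : b ^ (m + 1) ∣ c * w ^ N := hab.symm.pow.dvd_of_dvd_mul_right hN
  exact hm (hq.pow_dvd_of_dvd_mul_right _ (fun h => hqw (hq.dvd_of_dvd_pow h))
    ((pow_dvd_pow_of_dvd hqb _).trans h1))

/-- In lowest terms over the polynomial ring, the denominator of `a / b` divides a power of the
product of the variables, which maps to a homogeneous unit of `R_H`. -/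
theorem mem_homogeneousQuotientField_of_forall_pow_mul_mem_of_linearIndependent {ι : Type*}
    [Fintype ι] {u : ι → K} {d : ι → GrothendieckAddGroup Γ}
    (hu : ∀ i, u i ∈ homogeneousComponent 𝒜 K (d i)) (hu0 : ∀ i, u i ≠ 0)
    (hd : LinearIndependent ℤ d) {a b c : K}
    (ha : a ∈ gradedPart 𝒜 K (Submodule.span ℤ (Set.range d)))
    (hb : b ∈ gradedPart 𝒜 K (Submodule.span ℤ (Set.range d)))
    (hc : c ∈ gradedPart 𝒜 K (Submodule.span ℤ (Set.range d))) (hb0 : b ≠ 0) (hc0 : c ≠ 0)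
    (h : ∀ n : ℕ, (a / b) ^ n * c ∈ homogeneousQuotientField 𝒜 K) :
    a / b ∈ homogeneousQuotientField 𝒜 K := by
  set θ : MvPolynomial ι (degreeZeroSubfield 𝒜 K) →ₐ[_] K := MvPolynomial.aeval u with hθ
  have hinj : Function.Injective θ := aeval_injective 𝒜 hu hu0 hd
  set w : MvPolynomial ι (degreeZeroSubfield 𝒜 K) := ∏ i, MvPolynomial.X i with hw
  have hθw : θ w = ∏ i, u i := by simp [hθ, hw]
  have hw0 : θ w ≠ 0 := hθw ▸ Finset.prod_ne_zero_iff.2 fun i _ => hu0 i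
  have hrep := fun {x : K} hx => exists_aeval_eq_of_mem_gradedPart 𝒜 hu hu0 (x := x) hx
  rw [← hθ, ← hθw] at hrep
  obtain ⟨N₁, a₁, ha₁⟩ := hrep ha
  obtain ⟨N₂, b₁, hb₁⟩ := hrep hb
  obtain ⟨N₃, c₁, hc₁⟩ := hrep hc
  have hb₁0 : b₁ * w ^ N₁ ≠ 0 := by
    intro h0
    have := congrArg θ h0
    rw [map_mul, map_pow, ← hb₁, map_zero] at this
    simp_all
  -- The exponents `N₁` and `N₂` are crossed so that the quotient of the two images is `a / b`
  -- itself.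
  obtain ⟨a', b', e, hrel, hea, heb⟩ :=
    UniqueFactorizationMonoid.exists_reduced_factors' (a₁ * w ^ N₂) (b₁ * w ^ N₁) hb₁0
  have hb'0 : b' ≠ 0 := by
    rintro rfl
    exact hb₁0 (by rw [← heb, mul_zero])
  have hθb' : θ b' ≠ 0 := (map_ne_zero_iff θ hinj).2 hb'0
  have he0 : θ e ≠ 0 := (map_ne_zero_iff θ hinj).2 (by
    rintro rfl
    exact hb₁0 (by rw [← heb, zero_mul]))
  have hc₁0 : c₁ ≠ 0 := by
    rintro rfl
    rw [map_zero] at hc₁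
    simp_all
  have hab : a / b = θ a' / θ b' := by
    have h1 := congrArg θ hea
    have h2 := congrArg θ heb
    simp only [map_mul, map_pow, ← ha₁, ← hb₁] at h1 h2
    rw [div_eq_div_iff hb0 hθb']
    have h3 : θ e * (a * θ b' * θ w ^ (N₁ + N₂)) = θ e * (θ a' * b * θ w ^ (N₁ + N₂)) := by
      calc _ = a * θ w ^ (N₁ + N₂) * (θ e * θ b') := by ring
        _ = (θ e * θ a') * b * θ w ^ (N₁ + N₂) := by rw [h1, h2]; ring
        _ = _ := by ring
    exact mul_right_cancel₀ (pow_ne_zero (N₁ + N₂) hw0) (mul_left_cancel₀ he0 h3)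
  have hdvd : ∀ n : ℕ, ∃ N : ℕ, b' ^ n ∣ c₁ * w ^ N * a' ^ n := by
    intro n
    -- Membership in `R_H` improves to degrees in the span, because `b ^ n` times this element is `a
    -- ^ n * c`.
    have hmem : (a / b) ^ n * c ∈ gradedPart 𝒜 K (Submodule.span ℤ (Set.range d)) := by
      refine mem_gradedPart_of_mul_mem 𝒜 (pow_ne_zero n hb0) (pow_mem_gradedPart 𝒜 hb n) (h n) ?_
      have : b ^ n * ((a / b) ^ n * c) = a ^ n * c := by
        rw [div_pow]
        field_simp
      rw [this]
      exact mul_mem_gradedPart 𝒜 (fun _ h _ h' => Submodule.add_mem _ h h') (pow_mem_gradedPart 𝒜 ha n) hc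
    obtain ⟨N, p, hp⟩ := hrep hmem
    refine ⟨N, p * w ^ N₃, hinj ?_⟩
    simp only [map_mul, map_pow, ← hp, ← hc₁, hab, div_pow]
    field_simp
  obtain ⟨N, k, hk⟩ := exists_dvd_pow_of_forall_pow_dvd hb'0 hc₁0 hrel hdvd
  have hk' := congrArg θ hk
  rw [map_pow, map_mul] at hk'
  have hfin : a / b = θ a' * θ k * ((θ w)⁻¹) ^ N := by
    rw [hab, inv_pow, hk']
    have : θ k ≠ 0 := by
      intro h0
      rw [h0, mul_zero] at hk'
      exact pow_ne_zero N hw0 hk'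
    field_simp
  rw [hfin]
  refine mul_mem (mul_mem (aeval_mem_homogeneousQuotientField 𝒜 hu _)
    (aeval_mem_homogeneousQuotientField 𝒜 hu _)) (pow_mem ?_ N)
  rw [hθw]
  exact mem_homogeneousQuotientField_of_mem_homogeneousComponent 𝒜 (inv_mem_homogeneousComponent 𝒜
    (prod_mem_homogeneousComponent 𝒜 Finset.univ fun i _ => hu i))

/-- This supplies homogeneous `u i` whose degrees form a basis of the group generated by the
relevant degrees. -/
theorem exists_ne_zero_mem_homogeneousComponent_of_mem_span {T : Set Γ}
    (hT : ∀ γ ∈ T, ∃ r ∈ 𝒜 γ, r ≠ 0) {α : GrothendieckAddGroup Γ}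
    (hα : α ∈ Submodule.span ℤ (GrothendieckAddGroup.of '' T)) :
    ∃ x : K, x ∈ homogeneousComponent 𝒜 K α ∧ x ≠ 0 := by
  induction hα using Submodule.span_induction with
  | mem α hα =>
    obtain ⟨γ, hγ, rfl⟩ := hα
    obtain ⟨r, hr, hr0⟩ := hT γ hγ
    exact ⟨_, algebraMap_mem_homogeneousComponent 𝒜 hr, by simpa using hr0⟩
  | zero => exact ⟨1, one_mem_homogeneousComponent 𝒜, one_ne_zero⟩
  | add α β _ _ ih ih' =>
    obtain ⟨x, hx, hx0⟩ := ih
    obtain ⟨y, hy, hy0⟩ := ih'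
    exact ⟨x * y, mul_mem_homogeneousComponent 𝒜 hx hy, mul_ne_zero hx0 hy0⟩
  | smul n α _ ih =>
    obtain ⟨x, hx, hx0⟩ := ih
    exact ⟨x ^ n, zpow_mem_homogeneousComponent 𝒜 hx n, zpow_ne_zero n hx0⟩

theorem algebraMap_mem_gradedPart {A : Set (GrothendieckAddGroup Γ)} {a : R}
    (h : ∀ γ, (decompose 𝒜 a γ : R) ≠ 0 → GrothendieckAddGroup.of γ ∈ A) :
    algebraMap R K a ∈ gradedPart 𝒜 K A := by
  have := div_mem_gradedPart 𝒜 (K := K) (A := A) (b := a) (SetLike.one_mem_graded 𝒜)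
    (fun γ hγ => by simpa using h γ hγ)
  rwa [map_one, div_one] at this

/-- `R_H` is completely integrally closed in `K`. -/
theorem mem_homogeneousQuotientField_of_forall_pow_mul_mem [IsAddTorsionFree Γ] {x : K} {c : R}
    (hc : c ≠ 0) (h : ∀ n : ℕ, x ^ n * algebraMap R K c ∈ homogeneousQuotientField 𝒜 K) :
    x ∈ homogeneousQuotientField 𝒜 K := by
  classical
  obtain ⟨a, b, hb, rfl⟩ := IsFractionRing.div_surjective R x
  have hb0 : algebraMap R K b ≠ 0 := by simpa using nonZeroDivisors.ne_zero hb
  have hc0 : algebraMap R K c ≠ 0 := by simpa using hc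
  -- Only the degrees occurring in `a`, `b`, `c` matter. They generate a finitely generated
  -- torsion-free group, which is free.
  set T : Finset Γ := (decompose 𝒜 a).support ∪ (decompose 𝒜 b).support ∪ (decompose 𝒜 c).support
    with hT
  set G : Submodule ℤ (GrothendieckAddGroup Γ) :=
    Submodule.span ℤ (GrothendieckAddGroup.of '' (T : Set Γ)) with hG
  have hTne : ∀ γ ∈ (T : Set Γ), ∃ r ∈ 𝒜 γ, r ≠ 0 := by
    intro γ hγ
    simp only [hT, Finset.coe_union, Set.mem_union, Finset.mem_coe, DFinsupp.mem_support_iff] at hγ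
    rcases hγ with (hγ | hγ) | hγ
    all_goals exact ⟨_, SetLike.coe_mem _, fun h0 => hγ (Subtype.ext h0)⟩
  have hGfin : Module.Finite ℤ G :=
    Module.Finite.iff_fg.2 (Submodule.fg_span (T.finite_toSet.image _))
  let e := Module.Free.chooseBasis ℤ G
  choose u hu hu0 using fun i => exists_ne_zero_mem_homogeneousComponent_of_mem_span 𝒜 (K := K)
    hTne (e i).2
  have hspan : Submodule.span ℤ (Set.range fun i => (e i : GrothendieckAddGroup Γ)) = G := by
    have : Set.range (fun i => (e i : GrothendieckAddGroup Γ)) = G.subtype '' Set.range e :=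
      Set.range_comp _ _
    rw [this, Submodule.span_image, e.span_eq, Submodule.map_top, Submodule.range_subtype]
  have hmem : ∀ r : R, (decompose 𝒜 r).support ⊆ T →
      algebraMap R K r ∈ gradedPart 𝒜 K
        (Submodule.span ℤ (Set.range fun i => (e i : GrothendieckAddGroup Γ))) := by
    intro r hr
    rw [hspan]
    refine algebraMap_mem_gradedPart 𝒜 fun γ hγ => Submodule.subset_span ⟨γ, hr ?_, rfl⟩
    simpa using hγ
  have hsub : ∀ γ, (γ ∈ (decompose 𝒜 a).support ∨ γ ∈ (decompose 𝒜 b).support ∨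
      γ ∈ (decompose 𝒜 c).support) → γ ∈ T := by
    intro γ hγ
    simp only [hT, Finset.mem_union]
    tauto
  exact mem_homogeneousQuotientField_of_forall_pow_mul_mem_of_linearIndependent 𝒜 hu hu0
    (e.linearIndependent.map' G.subtype G.ker_subtype)
    (hmem a fun γ hγ => hsub γ (Or.inl hγ)) (hmem b fun γ hγ => hsub γ (Or.inr (Or.inl hγ)))
    (hmem c fun γ hγ => hsub γ (Or.inr (Or.inr hγ))) hb0 hc0 h

end QuotientGrading

section HomogeneousPreserving

variable {R : Type*} [CommRing R] {Γ : Type*} [AddCancelCommMonoid Γ] [DecidableEq Γ]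
  (𝒜 : Γ → AddSubgroup R) [GradedRing 𝒜] {K : Type*} [Field K] [Algebra R K]

/-! ### Homogeneous preserving operations -/

theorem isHomogeneousFractionalIdeal_coeSubmodule {I : Ideal R}
    (hI : I.IsHomogeneous 𝒜) : IsHomogeneousFractionalIdeal 𝒜 (coeSubmodule K I) :=
  ⟨1, one_mem _, I, hI, by rw [map_one, one_smul]⟩

theorem fg_coeSubmodule {I : Ideal R} (hI : I.FG) : (coeSubmodule K I).FG :=
  Submodule.FG.map (Algebra.linearMap R K) hI

theorem span_singleton_pow_mul_le_star (star : SemistarOperation R K) {x : K} {E H : Submodule R K}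
    (h : Submodule.span R {x} * H ≤ star (E * H)) (n : ℕ) :
    Submodule.span R {x} ^ n * H ≤ star (E ^ n * H) := by
  induction n with
  | zero => simpa using star.le_self H
  | succ n ih =>
    calc Submodule.span R {x} ^ (n + 1) * H
        = Submodule.span R {x} ^ n * (Submodule.span R {x} * H) := by rw [pow_succ, mul_assoc]
      _ ≤ star (Submodule.span R {x} ^ n * (E * H)) := star.mul_le_star_mul (star.le_self _) h
      _ = star (E * (Submodule.span R {x} ^ n * H)) := by rw [mul_left_comm]
      _ ≤ star (E ^ (n + 1) * H) := by
        refine star.le_star_of_le_star le_rfl ?_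
        rw [pow_succ', mul_assoc]
        exact star.mul_le_star_mul (star.le_self _) ih

theorem isHomogeneous_pow {I : Ideal R} (hI : I.IsHomogeneous 𝒜) (n : ℕ) :
    (I ^ n).IsHomogeneous 𝒜 := by
  induction n with
  | zero =>
    rw [pow_zero, Ideal.one_eq_top]
    exact Ideal.IsHomogeneous.top 𝒜
  | succ n ih =>
    rw [pow_succ]
    exact ih.mul hI

theorem isHomogeneous_span_singleton_mul {s : R} (hs : s ∈ nonzeroHomogeneous 𝒜) {I : Ideal R}
    (hI : I.IsHomogeneous 𝒜) : (Ideal.span {s} * I).IsHomogeneous 𝒜 :=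
  (Ideal.homogeneous_span 𝒜 _ fun _ hx => Set.mem_singleton_iff.1 hx ▸ hs.1).mul hI

variable [IsDomain R]

theorem span_singleton_mul_ne_bot {s : R} (hs : s ∈ nonzeroHomogeneous 𝒜) {I : Ideal R}
    (hI0 : I ≠ ⊥) : Ideal.span {s} * I ≠ ⊥ :=
  mul_ne_zero (by simpa using nonZeroDivisors.ne_zero hs.2) hI0

variable [IsFractionRing R K]

theorem exists_polynomial_smul_eq_coeSubmodule {L : Submodule R K} (hL : L.FG) (hL0 : L ≠ ⊥) :
    ∃ (d : K) (l : R[X]), d ≠ 0 ∧ l ≠ 0 ∧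
      d • L = coeSubmodule K (Ideal.span (Set.range l.coeff)) := by
  obtain ⟨r, hr, hrL⟩ := FractionalIdeal.isFractional_of_fg (S := R⁰) hL
  have hr0 : algebraMap R K r ≠ 0 := IsFractionRing.to_map_ne_zero_of_mem_nonZeroDivisors hr
  have hle : algebraMap R K r • L ≤ LinearMap.range (Algebra.linearMap R K) := by
    intro x hx
    obtain ⟨y, hy, rfl⟩ := (Submodule.mem_smul_pointwise_iff_exists _ _ _).1 hx
    obtain ⟨z, hz⟩ := hrL y hy
    exact ⟨z, by rw [Algebra.linearMap_apply, hz, Algebra.smul_def, smul_eq_mul]⟩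
  have hmap : coeSubmodule K ((algebraMap R K r • L).comap (Algebra.linearMap R K)) =
      algebraMap R K r • L := Submodule.map_comap_eq_of_le hle
  have hfg : ((algebraMap R K r • L).comap (Algebra.linearMap R K)).FG := by
    rw [← IsLocalization.coeSubmodule_fg (S := K) (IsFractionRing.injective R K), hmap]
    exact hL.map _
  obtain ⟨l, hl⟩ := exists_coeff_eq_of_fg hfg
  refine ⟨_, l, hr0, ?_, by rw [← hmap, ← hl]⟩
  rintro rfl
  have h0 : (algebraMap R K r • L).comap (Algebra.linearMap R K) = ⊥ := by
    rw [hl]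
    simp
  rw [h0, IsLocalization.coeSubmodule_bot] at hmap
  obtain ⟨x, hx, hx0⟩ := Submodule.exists_mem_ne_zero_of_ne_bot hL0
  have := Submodule.smul_mem_pointwise_smul x (algebraMap R K r) L hx
  rw [← hmap, Submodule.mem_bot, smul_eq_mul] at this
  exact (mul_ne_zero hr0 hx0) this

/-- The finitely generated submodules in the definition of `⋆_a` may be taken to be ideals of
`R`. -/
theorem SemistarOperation.exists_polynomial_mul_le_of_le_eab (star : SemistarOperation R K)
    {E F : Submodule R K} (hE : E.FG) (hF : F.FG) (h : F ≤ star.eab E) :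
    ∃ l : R[X], l ≠ 0 ∧ F * coeSubmodule K (Ideal.span (Set.range l.coeff)) ≤
      star (E * coeSubmodule K (Ideal.span (Set.range l.coeff))) := by
  obtain ⟨H, hH, hH0, hFH⟩ := (star.le_eab_iff hE hF).1 h
  obtain ⟨d, l, hd, hl, hdl⟩ := exists_polynomial_smul_eq_coeSubmodule hH hH0
  -- Replacing `H` by `d • H` scales both sides of the inclusion by `d`.
  refine ⟨l, hl, ?_⟩
  have hmul : ∀ A : Submodule R K, A * d • H = d • (A * H) := by
    intro A
    refine le_antisymm (Submodule.mul_le.2 ?_) ?_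
    · intro a ha y hy
      obtain ⟨z, hz, rfl⟩ := (Submodule.mem_smul_pointwise_iff_exists _ _ _).1 hy
      rw [mul_smul_comm]
      exact Submodule.smul_mem_pointwise_smul _ _ _ (Submodule.mul_mem_mul ha hz)
    · intro x hx
      obtain ⟨z, hz, rfl⟩ := (Submodule.mem_smul_pointwise_iff_exists _ _ _).1 hx
      clear hx
      induction hz using Submodule.mul_induction_on' with
      | mem_mul_mem a ha y hy =>
        rw [← mul_smul_comm]
        exact Submodule.mul_mem_mul ha (Submodule.smul_mem_pointwise_smul _ _ _ hy)
      | add x _ y _ hx hy =>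
        rw [smul_add]
        exact add_mem hx hy
  rw [← hdl, hmul, hmul, star.map_smul d hd]
  exact Submodule.map_mono hFH

/-! ### Test modules replaced by homogeneous contents -/

variable {𝒜} {star : SemistarOperation R K}

theorem SemistarOperation.IsHomogeneousPreserving.isHomogeneousSubmodule
    (hp : star.IsHomogeneousPreserving 𝒜) {I : Ideal R} (hI : I.IsHomogeneous 𝒜) (hI0 : I ≠ ⊥) :
    IsHomogeneousSubmodule 𝒜 K (star (coeSubmodule K I)) :=
  hp _ (coeSubmodule_ne_bot K hI0) (isHomogeneousFractionalIdeal_coeSubmodule 𝒜 hI)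

theorem IsHomogeneousSubmodule.coeSubmodule_homogeneousContent_le {E : Submodule R K}
    (hE : IsHomogeneousSubmodule 𝒜 K E) {a : R} (ha : algebraMap R K a ∈ E) :
    coeSubmodule K (homogeneousContent 𝒜 a) ≤ E := by
  rw [coeSubmodule, Submodule.map_le_iff_le_comap]
  exact (homogeneousContent_le 𝒜).2 fun γ => hE.algebraMap_decompose_mem ha γ

theorem IsHomogeneousSubmodule.fieldContent_le {E : Submodule R K}
    (hE : IsHomogeneousSubmodule 𝒜 K E) {f : R[X]} (hf : ∀ i, algebraMap R K (f.coeff i) ∈ E) :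
    fieldContent 𝒜 K f ≤ E := by
  rw [fieldContent, coeSubmodule, Submodule.map_le_iff_le_comap]
  exact (polyContent_le 𝒜).2 fun i γ => hE.algebraMap_decompose_mem (hf i) γ

/-- With `r_γ` a component of `r ∈ J`, the component of `l_i r_γ` in degree `δ + γ` is `(l_i)_δ
r_γ`. Homogeneity of `J` is what allows `r` to be replaced by `r_γ`. -/
theorem IsHomogeneousSubmodule.mul_fieldContent_le {E : Submodule R K}
    (hE : IsHomogeneousSubmodule 𝒜 K E) {J : Ideal R} (hJ : J.IsHomogeneous 𝒜) {l : R[X]}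
    (h : coeSubmodule K J * coeSubmodule K (Ideal.span (Set.range l.coeff)) ≤ E) :
    coeSubmodule K J * fieldContent 𝒜 K l ≤ E := by
  rw [fieldContent]
  rw [← IsLocalization.coeSubmodule_mul, coeSubmodule, Submodule.map_le_iff_le_comap,
    Ideal.mul_le] at h ⊢
  intro r hr
  suffices hl : ∀ γ, polyContent 𝒜 l ≤ Submodule.comap
      (LinearMap.mulLeft R (DirectSum.decompose 𝒜 r γ : R))
        (E.comap (Algebra.linearMap R K)) by
    classical
    intro s hs
    rw [← DirectSum.sum_support_decompose 𝒜 r, Finset.sum_mul]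
    exact sum_mem fun γ _ => hl γ hs
  intro γ
  refine (polyContent_le 𝒜).2 fun i δ => ?_
  have h1 : algebraMap R K (l.coeff i * DirectSum.decompose 𝒜 r γ) ∈ E := by
    rw [mul_comm]
    exact h _ (hJ γ hr) _ (Ideal.subset_span ⟨i, rfl⟩)
  have h2 := hE.algebraMap_decompose_mem h1 (δ + γ)
  rw [DirectSum.coe_decompose_mul_add_of_right_mem 𝒜 (SetLike.coe_mem _), mul_comm] at h2
  exact h2

theorem kronecker_eab (hp : star.IsHomogeneousPreserving 𝒜) :
    kronecker 𝒜 star = kronecker 𝒜 star.eab := by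
  refine Set.Subset.antisymm ?_ ?_
  · rintro φ ⟨f, g, hg, hφ, h, hh, hfg⟩
    exact ⟨f, g, hg, hφ, h, hh, star.le_eab_of_le_star
      (fg_coeSubmodule ((fg_polyContent 𝒜 g).mul (fg_polyContent 𝒜 h)))
      (fg_coeSubmodule ((fg_polyContent 𝒜 f).mul (fg_polyContent 𝒜 h))) hfg⟩
  · rintro φ ⟨f, g, hg, hφ, h, hh, hfg⟩
    obtain ⟨l, hl, hle⟩ := star.exists_polynomial_mul_le_of_le_eab
      (fg_coeSubmodule ((fg_polyContent 𝒜 g).mul (fg_polyContent 𝒜 h)))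
      (fg_coeSubmodule ((fg_polyContent 𝒜 f).mul (fg_polyContent 𝒜 h))) hfg
    -- The new test polynomial has content `𝒜_h 𝒜_l`, which absorbs the test ideal that comes from
    -- `⋆_a`.
    obtain ⟨h', hh'⟩ := exists_polyContent_eq 𝒜
      ((isHomogeneous_polyContent 𝒜 h).mul (isHomogeneous_polyContent 𝒜 l))
      ((fg_polyContent 𝒜 h).mul (fg_polyContent 𝒜 l))
    have hne := mul_ne_zero (polyContent_ne_bot 𝒜 hh) (polyContent_ne_bot 𝒜 hl)
    refine ⟨f, g, hg, hφ, h', ?_, ?_⟩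
    · rintro rfl
      rw [polyContent_zero] at hh'
      exact hne hh'.symm
    · rw [hh', ← mul_assoc, ← mul_assoc, IsLocalization.coeSubmodule_mul]
      have hE := hp.isHomogeneousSubmodule (I := polyContent 𝒜 g * polyContent 𝒜 h *
        polyContent 𝒜 l) (((isHomogeneous_polyContent 𝒜 g).mul
          (isHomogeneous_polyContent 𝒜 h)).mul (isHomogeneous_polyContent 𝒜 l))
        (mul_ne_zero (mul_ne_zero (polyContent_ne_bot 𝒜 hg) (polyContent_ne_bot 𝒜 hh))
          (polyContent_ne_bot 𝒜 hl))
      refine hE.mul_fieldContent_le ((isHomogeneous_polyContent 𝒜 f).mul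
        (isHomogeneous_polyContent 𝒜 h)) (hle.trans (star.mono _ _ ?_))
      rw [IsLocalization.coeSubmodule_mul K (_ * _) (polyContent 𝒜 l)]
      exact mul_le_mul' le_rfl (IsLocalization.coeSubmodule_mono K
        (span_coeff_le_polyContent 𝒜 l))

variable [IsAddTorsionFree Γ]

/-- Iterating `xL ⊆ (IL)^⋆`, with `L` generated by the coefficients of `l`, gives `x^n c ∈ (I^n
𝒜_l)^⋆ ⊆ R_H` for one fixed nonzero coefficient `c` of `l` and all `n`; complete integral closedness
then applies. -/
theorem mem_homogeneousQuotientField_of_mem_eab (hp : star.IsHomogeneousPreserving 𝒜)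
    {I : Ideal R} (hI0 : I ≠ ⊥) (hfg : I.FG) (hI : I.IsHomogeneous 𝒜) {x : K}
    (hx : x ∈ star.eab (coeSubmodule K I)) : x ∈ homogeneousQuotientField 𝒜 K := by
  obtain ⟨l, hl, hle⟩ := star.exists_polynomial_mul_le_of_le_eab
    (fg_coeSubmodule hfg) (Submodule.fg_span_singleton x)
    ((Submodule.span_singleton_le_iff_mem _ _).2 hx)
  obtain ⟨i, hi⟩ : ∃ i, l.coeff i ≠ 0 := by
    by_contra! h
    exact hl (Polynomial.ext h)
  refine mem_homogeneousQuotientField_of_forall_pow_mul_mem 𝒜 hi fun n => ?_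
  have hpow : coeSubmodule K (I ^ n) = coeSubmodule K I ^ n :=
    Submodule.map_pow I (Algebra.ofId R K) n
  have hIn := isHomogeneous_pow 𝒜 hI n
  have hE := hp.isHomogeneousSubmodule (I := I ^ n * polyContent 𝒜 l)
    (hIn.mul (isHomogeneous_polyContent 𝒜 l))
    (mul_ne_zero (pow_ne_zero n hI0) (polyContent_ne_bot 𝒜 hl))
  have hc : algebraMap R K (l.coeff i) ∈ coeSubmodule K (Ideal.span (Set.range l.coeff)) :=
    Submodule.mem_map_of_mem (f := Algebra.linearMap R K) (Ideal.subset_span ⟨i, rfl⟩)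
  have hxn : x ^ n * algebraMap R K (l.coeff i) ∈
      star (coeSubmodule K I ^ n * coeSubmodule K (Ideal.span (Set.range l.coeff))) :=
    span_singleton_pow_mul_le_star star hle n (Submodule.mul_mem_mul
      (Submodule.pow_mem_pow _ (Submodule.mem_span_singleton_self x) n) hc)
  have hmono : coeSubmodule K I ^ n * coeSubmodule K (Ideal.span (Set.range l.coeff)) ≤
      coeSubmodule K (I ^ n * polyContent 𝒜 l) := by
    rw [IsLocalization.coeSubmodule_mul, hpow]
    exact mul_le_mul' le_rfl (IsLocalization.coeSubmodule_mono K (span_coeff_le_polyContent 𝒜 l))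
  exact hE.mem_homogeneousQuotientField (star.mono _ _ hmono hxn)

/-- The products `a l_i` lie in the homogeneous module `(I 𝒜_l)^⋆`, which therefore contains
`𝒜_(la)`. Dedekind–Mertens separates `C(a)` from `𝒜_l` at the cost of a power, so `𝒜_l^(k+1)` is a
test module for `C(a)` against `I`. -/
theorem coeSubmodule_homogeneousContent_le_eab (hp : star.IsHomogeneousPreserving 𝒜)
    {I : Ideal R} (hI0 : I ≠ ⊥) (hfg : I.FG) (hI : I.IsHomogeneous 𝒜) {a : R}
    (ha : algebraMap R K a ∈ star.eab (coeSubmodule K I)) :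
    coeSubmodule K (homogeneousContent 𝒜 a) ≤ star.eab (coeSubmodule K I) := by
  have hfgK : (coeSubmodule K I).FG := fg_coeSubmodule hfg
  obtain ⟨l, hl, hle⟩ := star.exists_polynomial_mul_le_of_le_eab hfgK
    (Submodule.fg_span_singleton (algebraMap R K a))
    ((Submodule.span_singleton_le_iff_mem _ _).2 ha)
  have hE := hp.isHomogeneousSubmodule (I := I * polyContent 𝒜 l)
    (hI.mul (isHomogeneous_polyContent 𝒜 l)) (mul_ne_zero hI0 (polyContent_ne_bot 𝒜 hl))
  rw [IsLocalization.coeSubmodule_mul] at hE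
  have h1 : fieldContent 𝒜 K (l * Polynomial.C a) ≤
      star (coeSubmodule K I * fieldContent 𝒜 K l) := by
    refine hE.fieldContent_le fun i => ?_
    have hc : algebraMap R K (l.coeff i) ∈ coeSubmodule K (Ideal.span (Set.range l.coeff)) :=
      Submodule.mem_map_of_mem (f := Algebra.linearMap R K) (Ideal.subset_span ⟨i, rfl⟩)
    have hac := hle (Submodule.mul_mem_mul (Submodule.mem_span_singleton_self _) hc)
    have hmono : coeSubmodule K I * coeSubmodule K (Ideal.span (Set.range l.coeff)) ≤
        coeSubmodule K I * fieldContent 𝒜 K l :=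
      mul_le_mul' le_rfl (IsLocalization.coeSubmodule_mono K (span_coeff_le_polyContent 𝒜 l))
    rw [Polynomial.coeff_mul_C, mul_comm (l.coeff i) a, map_mul]
    exact star.mono _ _ hmono hac
  obtain ⟨k, hk⟩ := exists_fieldContent_pow_mul_le 𝒜 K l (Polynomial.C a)
  rw [← polyContent_C]
  refine (star.le_eab_iff hfgK (fg_fieldContent 𝒜 K (Polynomial.C a))).2
    ⟨fieldContent 𝒜 K l ^ k * fieldContent 𝒜 K l,
      ((fg_fieldContent 𝒜 K l).pow k).mul (fg_fieldContent 𝒜 K l),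
      mul_ne_zero (pow_ne_zero k (fieldContent_ne_bot 𝒜 K hl)) (fieldContent_ne_bot 𝒜 K hl), ?_⟩
  rw [mul_comm, mul_assoc, mul_left_comm (coeSubmodule K I)]
  exact hk.trans (star.mul_le_star_mul (star.le_self _) h1)

end HomogeneousPreserving

end GradedKronecker

theorem mainTheorem8 {R : Type*} [CommRing R] [IsDomain R]
    {Γ : Type*} [AddCancelCommMonoid Γ] [IsAddTorsionFree Γ] [DecidableEq Γ]
    (𝒜 : Γ → AddSubgroup R) [GradedRing 𝒜]
    {K : Type*} [Field K] [Algebra R K] [IsFractionRing R K]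
    (star : GradedKronecker.SemistarOperation R K) :
    -- the e.a.b. case
    (star.IsEAB →
      GradedKronecker.kronecker 𝒜 star =
          {φ | ∃ f g : Polynomial R, g ≠ 0 ∧
            φ = GradedKronecker.toRatFunc K f / GradedKronecker.toRatFunc K g ∧
            IsLocalization.coeSubmodule K (GradedKronecker.polyContent 𝒜 f) ≤
              star (IsLocalization.coeSubmodule K (GradedKronecker.polyContent 𝒜 g))} ∧
        ∃ S : Subring (RatFunc K), (S : Set (RatFunc K)) = GradedKronecker.kronecker 𝒜 star ∧
          IsDomain S ∧ IsBezout S ∧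
          (star.IsHomogeneousPreserving 𝒜 →
            ∀ I : Ideal R, I ≠ ⊥ → I.FG → I.IsHomogeneous 𝒜 →
              (star (IsLocalization.coeSubmodule K I) : Set K) =
                {d | RatFunc.C d ∈ GradedKronecker.extendIdeal S I} ∩
                  (GradedKronecker.homogeneousQuotientField 𝒜 K : Set K))) ∧
    -- the homogeneous preserving case
    (star.IsHomogeneousPreserving 𝒜 →
      star (1 : Submodule R K) <
        Subalgebra.toSubmodule (GradedKronecker.homogeneousQuotientField 𝒜 K) →
      GradedKronecker.kronecker 𝒜 star = GradedKronecker.kronecker 𝒜 star.eab ∧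
        ∃ S : Subring (RatFunc K), (S : Set (RatFunc K)) = GradedKronecker.kronecker 𝒜 star ∧
          IsDomain S ∧ IsBezout S ∧
          ∀ I : Ideal R, I ≠ ⊥ → I.FG → I.IsHomogeneous 𝒜 →
            (star.eab (IsLocalization.coeSubmodule K I) : Set K) =
              {d | RatFunc.C d ∈ GradedKronecker.extendIdeal S I} ∩
                (GradedKronecker.homogeneousQuotientField 𝒜 K : Set K)) := by
  open GradedKronecker in
  refine ⟨fun hs => ⟨?_, kroneckerSubring 𝒜 hs, rfl, inferInstance,
    isBezout_kroneckerSubring 𝒜 hs, fun hp I hI0 hfg hI => ?_⟩, fun hp _ => ⟨kronecker_eab hp,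
    kroneckerSubring 𝒜 star.isEAB_eab, (kronecker_eab hp).symm, inferInstance,
    isBezout_kroneckerSubring 𝒜 star.isEAB_eab, fun I hI0 hfg hI => ?_⟩⟩
  · exact Set.ext fun φ => hs.mem_kronecker_iff 𝒜
  · refine star_eq_extendIdeal_inter 𝒜 hs hI0 hfg hI
      (fun d hd => (hp.isHomogeneousSubmodule hI hI0).mem_homogeneousQuotientField hd)
      fun a s hsH ha => ?_
    exact (hp.isHomogeneousSubmodule (isHomogeneous_span_singleton_mul 𝒜 hsH hI)
      (span_singleton_mul_ne_bot 𝒜 hsH hI0)).coeSubmodule_homogeneousContent_le ha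
  -- Only the two conditions on finitely generated homogeneous ideals are checked for `⋆_a`, so its
  -- homogeneous preservation need not be established.
  · refine star_eq_extendIdeal_inter 𝒜 star.isEAB_eab hI0 hfg hI
      (fun d hd => mem_homogeneousQuotientField_of_mem_eab hp hI0 hfg hI hd)
      fun a s hsH ha => ?_
    exact coeSubmodule_homogeneousContent_le_eab hp (span_singleton_mul_ne_bot 𝒜 hsH hI0)
      ((Submodule.fg_span_singleton s).mul hfg) (isHomogeneous_span_singleton_mul 𝒜 hsH hI) ha
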